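/- **Setting.** Let $\alpha>1$ and $\beta>2$. Let $(f^{\rm in}_k)_{k\ge 0}$ and $(f^{\rm out}_k)_{k\ge 0}$ be probability distributions on $\{0,1,2,\dots\}$ with the same finite mean $\mu=\sum_k k f^{\rm in}_k=\sum_k k f^{\rm out}_k>1$, such that for all $x>0$ $$\sum_{k>x} f^{\rm in}_k\le x^{-\alpha}L_{\rm in}(x),\qquad \sum_{k>x} f^{\rm out}_k\le x^{-\beta}L_{\rm out}(x)$$ for some slowly varying functions $L_{\rm in},L_{\rm out}$ (positive, measurable, $L(tx)/L(x)\to 1$ as $x\to\infty$ for all $t>0$). Let $\kappa_0=\min\{1-\alpha^{-1},1-\beta^{-1},1/2\}$ and fix $0<\delta_0<\kappa_0$. **Bi-degree sequence (Algorithm 1).** Given $n$, sample $\mathscr N_1,\dots,\mathscr N_n$ i.i.d. from $f^{\rm in}$ and, independently, $\mathscr D_1,\dots,\mathscr D_n$ i.i.d. from $f^{\rm out}$, and put $\Delta_n=\sum_{i=1}^n(\mathscr N_i-\mathscr D_i)$. Repeat independently until $|\Delta_n|\le n^{1-\kappa_0+\delta_0}$. Then choose $|\Delta_n|$ of the $n$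 nodes uniformly without replacement, and for each chosen node $i$ set $N_i=\mathscr N_i+1$, $D_i=\mathscr D_i$ if $\Delta_n<0$, and $N_i=\mathscr N_i$, $D_i=\mathscr D_i+1$ if $\Delta_n\ge 0$; for all other nodes set $N_i=\mathscr N_i$, $D_i=\mathscr D_i$. Node $i$ gets $N_i$ inbound and $D_i$ outbound stubs; the total number of outbound stubs is $L_n=\sum_i D_i=\sum_i N_i$. **Exploration.** Choose a root uniformly among the $n$ nodes; it has generation $0$. Its outbound stubs get label 2, all other outbound stubs label 1, and its inbound stubs form a queue. For the first inbound stub in the queue, belonging to a node of generation $r$, draw an outbound stub uniformly from all $L_n$ outbound stubs, independently of all earlier draws and with replacement. If it has label 1, its node is attached and gets generation $r+1$, the stub gets label 3, the other outbound stubs of that node get label 2, the inbound stub leaves the queue, and the inbound stubs of the new node join the end of the queue. If it has label 2, it gets label 3 and the inbound stub leaves the queue. If it has label 3, it is discarded and there is a redraw. The procedure stops when the queue is empty. As long as only stubs with label 1 have been drawn, the graph explored coincides with the branching tree built from the same draws, in which every draw produces a new individual, and the generation of a node is its distance to the root. Let $\tau$ be the number of generations of this tree that are completed before the first outbound stub with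 label 2 or 3 is drawn; that is, $\tau=r$ if the first inbound stub to draw an outbound stub with label 2 or 3 belongs to a node of generation $r$, and $\tau=\infty$ if no such stub is ever drawn. **Statement.** For every $h$ with $0<h<1/(2\log\mu)$ there are $\delta>0$, $C$ and $n_0$ such that for all $n\ge n_0$ the generation of the bi-degree sequence terminates almost surely, and for all integers $k$ with $1\le k\le h\log n$, $$P(\tau\le k)\le C\,n^{-\delta}.$$ -/

import Mathlib

open MeasureTheory ProbabilityTheory Filter
open scoped ENNReal

namespace DirectedConfiguration

noncomputable section

/-- Slowly varying functions on the positive half-line: positive and measurable, with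
`L (t x) / L x → 1` as `x → ∞` for every `t > 0`. -/
structure SlowlyVarying (L : ℝ → ℝ) : Prop where
  measurable : Measurable L
  pos : ∀ x : ℝ, 0 < x → 0 < L x
  tendsto_ratio : ∀ t : ℝ, 0 < t → Tendsto (fun x : ℝ => L (t * x) / L x) atTop (nhds 1)

/-- The tail `∑_{k > x} f_k` of the distribution `f` is at most `x ^ (-a) * L x` for all `x > 0`,
for some slowly varying `L`. -/
def HasTailIndex (f : PMF ℕ) (a : ℝ) : Prop :=
  ∃ L : ℝ → ℝ, SlowlyVarying L ∧
    ∀ x : ℝ, 0 < x → (f.toMeasure {k : ℕ | x < (k : ℝ)}).toReal ≤ x ^ (-a) * L x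

/-- The distribution `f` on `ℕ` has (finite) mean `m`. -/
def HasMean (f : PMF ℕ) (m : ℝ) : Prop :=
  HasSum (fun k : ℕ => (k : ℝ) * (f k).toReal) m

/-- The constant `κ₀ = min {1 - 1/α, 1 - 1/β, 1/2}`. -/
def kappa (α β : ℝ) : ℝ := min (min (1 - α⁻¹) (1 - β⁻¹)) (1 / 2)

/-- A pair of degree sequences on the nodes `Fin n`: in-degrees, then out-degrees. -/
abbrev Degrees (n : ℕ) : Type := (Fin n → ℕ) × (Fin n → ℕ)

/-! ### Generation of the bi-degree sequence -/

/-- The law of one attempt: `n` i.i.d. in-degrees with law `fIn` and, independently of them,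
`n` i.i.d. out-degrees with law `fOut`. -/
def attemptLaw (fIn fOut : PMF ℕ) (n : ℕ) : Measure (Degrees n) :=
  (Measure.pi fun _ : Fin n => fIn.toMeasure).prod (Measure.pi fun _ : Fin n => fOut.toMeasure)

/-- `Δ_n`, the sum of the in-degrees minus the sum of the out-degrees. -/
def excess {n : ℕ} (p : Degrees n) : ℤ := ∑ i, ((p.1 i : ℤ) - (p.2 i : ℤ))

/-- The attempts that are accepted: `|Δ_n| ≤ n ^ (1 - κ₀ + δ₀)`. -/
def accepted (α β δ₀ : ℝ) (n : ℕ) : Set (Degrees n) :=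
  {p | |(excess p : ℝ)| ≤ (n : ℝ) ^ (1 - kappa α β + δ₀)}

/-- Given the set `S` of chosen nodes, add one inbound stub to each of them if `Δ_n < 0`, and one
outbound stub to each of them if `Δ_n ≥ 0`. -/
def adjust {n : ℕ} (p : Degrees n) (S : Finset (Fin n)) : Degrees n :=
  (fun i => if excess p < 0 ∧ i ∈ S then p.1 i + 1 else p.1 i,
   fun i => if 0 ≤ excess p ∧ i ∈ S then p.2 i + 1 else p.2 i)

/-- The law of `adjust p S` when `S` is a uniformly random set of `|Δ_n|` nodes. -/
def adjustLaw {n : ℕ} (p : Degrees n) : Measure (Degrees n) :=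
  ((n.choose (excess p).natAbs : ℕ) : ℝ≥0∞)⁻¹ •
    ∑ S ∈ Finset.powersetCard (excess p).natAbs (Finset.univ : Finset (Fin n)),
      Measure.dirac (adjust p S)

/-- The law of the bi-degree sequence `(N_n, D_n)`. Independent attempts are repeated until one is
accepted, so the pair of sequences that is kept has the law of one attempt conditioned on being
accepted; then `|Δ_n|` uniformly chosen nodes receive one more stub each. -/
def biDegreeLaw (fIn fOut : PMF ℕ) (α β δ₀ : ℝ) (n : ℕ) : Measure (Degrees n) :=
  (ProbabilityTheory.cond (attemptLaw fIn fOut n) (accepted α β δ₀ n)).bind adjustLaw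

/-! ### Exploration of the graph -/

/-- The outbound stubs of all nodes: node `i` has `D i` of them. -/
abbrev OutStub {n : ℕ} (D : Fin n → ℕ) : Type := Σ i : Fin n, Fin (D i)

/-- Labels of outbound stubs. Label `one`: the node of the stub is not yet attached to the graph;
label `two`: the node is attached, the stub is not yet paired; label `three`: the stub is
paired with an inbound stub. -/
inductive StubLabel : Type
  | one : StubLabel
  | two : StubLabel
  | three : StubLabel

/-- State of the exploration: the labels of the outbound stubs, and the queue of the unpaired
inbound stubs of the attached nodes, in the order in which they will be paired. An inbound stub is
recorded as `(i, r)`, where `i` is the node it belongs to and `r` the generation of `i`, that is,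
the distance from `i` to the root. -/
structure Exploration {n : ℕ} (D : Fin n → ℕ) : Type where
  label : OutStub D → StubLabel
  pending : List (Fin n × ℕ)

/-- Initially only the root is attached: its outbound stubs have label `two`, all others
label `one`, and its inbound stubs wait to be paired. -/
def Exploration.init {n : ℕ} (d : Degrees n) (root : Fin n) : Exploration d.2 where
  label t := if t.1 = root then StubLabel.two else StubLabel.one
  pending := List.replicate (d.1 root) (root, 0)

/-- One draw of an outbound stub `s`, for the inbound stub at the head of the queue. If `s` has
label `one`, its node is attached in the next generation, `s` gets label `three` and its siblings
label `two`, and the inbound stubs of the new node join the end of the queue. If `s` has label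
`two`, it is paired and gets label `three`. If `s` has label `three`, it is discarded and there is
a redraw. Nothing happens once the queue is empty. -/
def Exploration.step {n : ℕ} (d : Degrees n) (e : Exploration d.2) (s : OutStub d.2) :
    Exploration d.2 :=
  match e.pending with
  | [] => e
  | (_, r) :: rest =>
    match e.label s with
    | StubLabel.one =>
      { label := fun t =>
          if t = s then StubLabel.three else if t.1 = s.1 then StubLabel.two else e.label t
        pending := rest ++ List.replicate (d.1 s.1) (s.1, r + 1) }
    | StubLabel.two =>
      { label := fun t => if t = s then StubLabel.three else e.label t
        pending := rest }
    | StubLabel.three => e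

/-- The state after the first `m` draws of the sequence `ω`. -/
def explore {n : ℕ} (d : Degrees n) (root : Fin n) (ω : ℕ → OutStub d.2) : ℕ → Exploration d.2
  | 0 => Exploration.init d root
  | m + 1 => (explore d root ω m).step d (ω m)

/-- Draw number `m` is made for an inbound stub of a node of generation `r` and yields an outbound
stub with label `two` or `three`. -/
def BadDraw {n : ℕ} (d : Degrees n) (root : Fin n) (ω : ℕ → OutStub d.2) (m r : ℕ) : Prop :=
  (∃ i : Fin n, (explore d root ω m).pending.head? = some (i, r)) ∧
    (explore d root ω m).label (ω m) ≠ StubLabel.one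

/-- The coupling of graph and tree breaks at draw number `m`, made for an inbound stub of a node of
generation `r`: this is the first draw of an outbound stub with label `two` or `three`. Up to this
draw every draw attaches a new node to the graph and the same node to the tree, so that the
generations in the graph and in the tree agree. -/
def CouplingBreaks {n : ℕ} (d : Degrees n) (root : Fin n) (ω : ℕ → OutStub d.2) (m r : ℕ) : Prop :=
  BadDraw d root ω m r ∧ ∀ m' < m, ∀ r' : ℕ, ¬ BadDraw d root ω m' r'

/-- `τ`: the generation of the node for whose inbound stub an outbound stub with label `two` or
`three` is drawn for the first time, and `⊤` if this never happens. There is at most one pair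
`(m, r)` with `CouplingBreaks d root ω m r`. -/
def tau {n : ℕ} (d : Degrees n) (root : Fin n) (ω : ℕ → OutStub d.2) : ℕ∞ :=
  sInf {x : ℕ∞ | ∃ m r : ℕ, CouplingBreaks d root ω m r ∧ x = (r : ℕ∞)}

/-- The law of the draws: independent and uniform on all outbound stubs, with replacement. (If
there is no outbound stub, there is no sequence of draws either, and this is the zero measure.) -/
def drawLaw {n : ℕ} (D : Fin n → ℕ) : Measure (ℕ → OutStub D) :=
  Measure.infinitePi fun _ : ℕ => uniformOn (Set.univ : Set (OutStub D))

/-- `P(τ ≤ k)`: the bi-degree sequence is drawn from its law, then a uniformly chosen node is the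
root, then the outbound stubs are drawn. -/
def probTauLE (fIn fOut : PMF ℕ) (α β δ₀ : ℝ) (n k : ℕ) : ℝ≥0∞ :=
  ∫⁻ d, (n : ℝ≥0∞)⁻¹ * ∑ root : Fin n, drawLaw d.2 {ω | tau d root ω ≤ (k : ℕ∞)}
    ∂(biDegreeLaw fIn fOut α β δ₀ n)

end

end DirectedConfiguration

/-! ### Moments from tail bounds. -/

namespace DirectedConfiguration

/-! Fix the degrees and the root, and cut at `x` draws. If the coupling breaks within `k`
generations, then either one of the first `x` draws hits the root or the node of an earlier draw, or
the first `x` draws are all harmless and all made within the first `k` generations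
(`tau_le_subset`). The node of a draw is size-biased by out-degree, so with `L = ∑ D_i` a union
bound gives at most `x D_root / L + x² ∑ D_i² / L²` for the first event. For the second, give each
queued stub the mean number of draws it still causes in a branching tree with offspring mean `M ≥ ∑
N_i D_i / L`. The total weight loses at least one on average per draw
(`lintegral_queueWeight_succ_le`), so the expected number of such draws is at most `N_root (1 + M +
... + M^k)`, and Markov's inequality divides this by `x`.

Now average over the root. In an attempt the in- and out-degrees are independent, so `∑ N_i D_i` is
near `n μ²` and `L` near `n μ`; hence any fixed `M = exp s > μ` is admissible with high probability.
Since `β > 2`, `∑ D_i²` is at most `n^(1+ε)` with high probability. With `x` of order `n^b` the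
bound has order `n^(b-1) + n^(2b-1+ε) + n^(hs-b)`, which decays when `h s < b < 1/2`; this is
possible because `h log μ < 1/2`.

The moment estimates hold up to polynomially small probability, by truncation and Chebyshev's
inequality (`measureReal_pi_sum_deviation_le`). Conditioning on acceptance at most doubles such
probabilities, acceptance having probability at least `1/2`. The adjustment alters `∑ N_i D_i` by
`o(n)` whatever nodes are chosen (`sum_mul_adjust_le`). -/

theorem HasTailIndex.integrable_rpow {f : PMF ℕ} {a q : ℝ} (hf : HasTailIndex f a)
    (hq : 0 < q) (hqa : q < a) : Integrable (fun k : ℕ => (k : ℝ) ^ q) f.toMeasure := by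
  obtain ⟨L, hL, htail⟩ := hf
  set u : ℕ → ℝ := fun j => ((2 : ℝ) ^ j) ^ (q - a) * L (2 ^ j) with hu
  have hupos : ∀ j, 0 < u j := fun j => by
    have := hL.pos (2 ^ j) (by positivity)
    positivity
  -- Slow variation is used only for the factor 2: along dyadic points the contributions behave like
  -- a geometric series of ratio `2 ^ (q - a) < 1`.
  have hratio : Tendsto (fun j => ‖u (j + 1)‖ / ‖u j‖) atTop (nhds ((2 : ℝ) ^ (q - a))) := by
    have h1 : Tendsto (fun j : ℕ => L (2 * 2 ^ j) / L (2 ^ j)) atTop (nhds 1) :=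
      (hL.tendsto_ratio 2 (by norm_num)).comp
        (tendsto_pow_atTop_atTop_of_one_lt (by norm_num : (1 : ℝ) < 2))
    have h2 := h1.const_mul ((2 : ℝ) ^ (q - a))
    rw [mul_one] at h2
    refine h2.congr fun j => ?_
    have h3 := hL.pos (2 ^ j) (by positivity)
    rw [Real.norm_of_nonneg (hupos _).le, Real.norm_of_nonneg (hupos _).le]
    simp only [hu, pow_succ']
    rw [Real.mul_rpow (by norm_num) (by positivity)]
    field_simp
  have hsum : Summable u := summable_of_ratio_test_tendsto_lt_one
    (Real.rpow_lt_one_of_one_lt_of_neg (by norm_num) (by linarith))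
    (Eventually.of_forall fun j => (hupos j).ne') hratio
  have hpt : ∀ k : ℕ, ENNReal.ofReal ((k : ℝ) ^ q) ≤ 1 + ∑' j : ℕ,
      Set.indicator {k : ℕ | (2 : ℝ) ^ j < k}
        (fun _ => ENNReal.ofReal (4 ^ q * ((2 : ℝ) ^ j) ^ q)) k := by
    intro k
    rcases Nat.lt_or_ge k 2 with hk | hk
    · refine le_trans ?_ le_self_add
      rw [ENNReal.ofReal_le_one]
      exact Real.rpow_le_one (by positivity) (by exact_mod_cast Nat.lt_succ_iff.mp hk) hq.le
    -- With `2 ^ j ≤ k < 2 ^ (j + 1)`, stepping down to `i = j - 1` makes `2 ^ i < k` strict, as in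
    -- the tail hypothesis; this costs the factor 4 in `k ≤ 4 * 2 ^ i`.
    · obtain ⟨j, hj1, hj2⟩ := exists_nat_pow_near (x := (k : ℝ)) (y := 2)
        (by exact_mod_cast (by lia : 1 ≤ k)) (by norm_num)
      have hj : j ≠ 0 := by
        rintro rfl
        have : (2 : ℝ) ≤ k := by exact_mod_cast hk
        norm_num at hj2
        linarith
      obtain ⟨i, rfl⟩ := Nat.exists_eq_succ_of_ne_zero hj
      refine le_trans ?_ (le_add_of_nonneg_left zero_le_one)
      refine le_trans ?_ (ENNReal.le_tsum i)
      have hi : (0 : ℝ) < 2 ^ i := by positivity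
      rw [Set.indicator_of_mem]
      · refine ENNReal.ofReal_le_ofReal ?_
        rw [← Real.mul_rpow (by norm_num) hi.le]
        refine Real.rpow_le_rpow (by positivity) ?_ hq.le
        rw [pow_succ, pow_succ] at hj2
        linarith
      · show (2 : ℝ) ^ i < k
        rw [pow_succ] at hj1
        linarith
  refine ⟨Measurable.of_discrete.aestronglyMeasurable, ?_⟩
  rw [hasFiniteIntegral_iff_ofReal (Eventually.of_forall fun k => by positivity)]
  refine lt_of_le_of_lt (lintegral_mono hpt) ?_
  rw [lintegral_add_left measurable_const,
    lintegral_tsum fun j => Measurable.of_discrete.aemeasurable]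
  refine ENNReal.add_lt_top.2 ⟨by simp, ?_⟩
  refine lt_of_le_of_lt (ENNReal.tsum_le_tsum
    (g := fun j => ENNReal.ofReal (4 ^ q * u j)) fun j => ?_) ?_
  · rw [lintegral_indicator_const (MeasurableSet.of_discrete),
      ← ENNReal.ofReal_toReal (measure_ne_top f.toMeasure _),
      ← ENNReal.ofReal_mul (by positivity)]
    refine ENNReal.ofReal_le_ofReal ?_
    have h2 : (0 : ℝ) < 2 ^ j := by positivity
    have h1 := htail (2 ^ j) h2
    calc _ ≤ 4 ^ q * ((2 : ℝ) ^ j) ^ q * ((2 ^ j) ^ (-a) * L (2 ^ j)) := by gcongr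
      _ = _ := by rw [hu]; simp only; rw [sub_eq_add_neg, Real.rpow_add h2]; ring
  · rw [← ENNReal.ofReal_tsum_of_nonneg (fun j => by have := hupos j; positivity)
      (hsum.mul_left _)]
    exact ENNReal.ofReal_lt_top

theorem HasMean.integral_eq {f : PMF ℕ} {m : ℝ} (hf : HasMean f m) :
    ∫ k, (k : ℝ) ∂f.toMeasure = m := by
  rw [PMF.integral_eq_tsum]
  · rw [← hf.tsum_eq]
    exact tsum_congr fun k => by rw [smul_eq_mul, mul_comm]
  · refine ⟨Measurable.of_discrete.aestronglyMeasurable, ?_⟩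
    rw [hasFiniteIntegral_iff_ofReal (Eventually.of_forall fun k => by positivity),
      lintegral_countable']
    simp only [PMF.toMeasure_apply_singleton _ _ (measurableSet_singleton _)]
    have : ∀ k : ℕ, ENNReal.ofReal (k : ℝ) * f k = ENNReal.ofReal (k * (f k).toReal) := fun k => by
      rw [ENNReal.ofReal_mul (by positivity), ENNReal.ofReal_toReal (f.apply_ne_top k)]
    simp only [this]
    rw [← ENNReal.ofReal_tsum_of_nonneg (fun j => by positivity) hf.summable]
    exact ENNReal.ofReal_lt_top

/-! ### Truncation and a law of large numbers with a rate. -/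

theorem sq_indicator_le {Y : Type*} {φ : Y → ℝ} {q t : ℝ} (hq2 : q ≤ 2) (ht : 0 < t)
    (y : Y) :
    ({y | |φ y| ≤ t}.indicator φ y) ^ 2 ≤ t ^ (2 - q) * |φ y| ^ q := by
  by_cases hy : |φ y| ≤ t
  · rw [Set.indicator_of_mem (by exact hy), ← sq_abs]
    rcases (abs_nonneg (φ y)).eq_or_lt with h0 | h0
    · rw [← h0]; simp; positivity
    · calc |φ y| ^ 2 = |φ y| ^ (2 - q) * |φ y| ^ q := by
            rw [← Real.rpow_add h0]; norm_num
        _ ≤ _ := by gcongr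
  · rw [Set.indicator_of_notMem (by exact hy)]
    simp only [ne_eq, OfNat.ofNat_ne_zero, not_false_eq_true, zero_pow]
    positivity

/-- Controls the bias caused by truncating at level `t`; `sq_indicator_le` controls the variance of
the truncated part. Both trade powers of `t` against the moment of order `q`. -/
theorem abs_sub_indicator_le {Y : Type*} {φ : Y → ℝ} {q t : ℝ} (hq1 : 1 < q) (ht : 0 < t) (y : Y) :
    |φ y - {y | |φ y| ≤ t}.indicator φ y| ≤ t ^ (1 - q) * |φ y| ^ q := by
  by_cases hy : |φ y| ≤ t
  · rw [Set.indicator_of_mem (by exact hy), sub_self, abs_zero]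
    positivity
  · rw [Set.indicator_of_notMem (by exact hy), sub_zero]
    push Not at hy
    have h0 : 0 < |φ y| := ht.trans hy
    calc |φ y| = |φ y| ^ (1 - q) * |φ y| ^ q := by rw [← Real.rpow_add h0]; norm_num
      _ ≤ _ := by
        gcongr ?_ * _
        exact Real.rpow_le_rpow_of_nonpos ht hy.le (by linarith)

section Deviation
variable {Y : Type*} [MeasurableSpace Y] {ν : Measure Y} [IsProbabilityMeasure ν] {φ : Y → ℝ}

theorem integral_pi_sum (n : ℕ) (hφ : Integrable φ ν) :
    ∫ y, ∑ i, φ (y i) ∂(Measure.pi fun _ : Fin n => ν) = n * ∫ y, φ y ∂ν := by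
  rw [integral_finsetSum]
  · have : ∀ i : Fin n, ∫ y, φ (y i) ∂(Measure.pi fun _ : Fin n => ν) = ∫ y, φ y ∂ν := fun i =>
      integral_comp_eval (μ := fun _ : Fin n => ν) hφ.aestronglyMeasurable
    simp [this]
  · exact fun i _ => integrable_comp_eval (μ := fun _ : Fin n => ν) hφ

theorem integrable_pi_sum (n : ℕ) (hφ : Integrable φ ν) :
    Integrable (fun y => ∑ i, φ (y i)) (Measure.pi fun _ : Fin n => ν) :=
  integrable_finsetSum _ fun _ _ => integrable_comp_eval (μ := fun _ : Fin n => ν) hφ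

theorem measureReal_lt_le_integral_div {Z : Type*} [MeasurableSpace Z] {ρ : Measure Z}
    [IsFiniteMeasure ρ] {g : Z → ℝ} (hg : Integrable g ρ) (hg0 : ∀ z, 0 ≤ g z) {t : ℝ}
    (ht : 0 < t) : ρ.real {z | t < g z} ≤ (∫ z, g z ∂ρ) / t := by
  rw [le_div_iff₀ ht, mul_comm]
  refine le_trans ?_ (mul_meas_ge_le_integral_of_nonneg (Eventually.of_forall hg0) hg t)
  gcongr
  · exact measure_ne_top _ _
  · exact fun h => le_of_lt h

theorem measureReal_pi_sum_lt_le (hφ : Integrable φ ν) (hφ0 : ∀ y, 0 ≤ φ y) (n : ℕ) {t : ℝ}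
    (ht : 0 < t) :
    (Measure.pi fun _ : Fin n => ν).real {y | t < ∑ i, φ (y i)} ≤ n * (∫ y, φ y ∂ν) / t := by
  rw [← integral_pi_sum n hφ]
  exact measureReal_lt_le_integral_div (integrable_pi_sum n hφ)
    (fun y => Finset.sum_nonneg fun i _ => hφ0 _) ht

theorem integrable_of_integrable_abs_rpow {q : ℝ} (hφ : Measurable φ) (hq1 : 1 < q)
    (hint : Integrable (fun y => |φ y| ^ q) ν) : Integrable φ ν := by
  refine ((integrable_const (1 : ℝ)).add hint).mono' hφ.aestronglyMeasurable
    (Eventually.of_forall fun y => ?_)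
  simp only [Pi.add_apply, Real.norm_eq_abs]
  rcases le_total (|φ y|) 1 with h | h
  · have : 0 ≤ |φ y| ^ q := by positivity
    linarith
  · have := Real.self_le_rpow_of_one_le h hq1.le
    linarith

/-- A weak law of large numbers with a polynomial rate, for summands with a finite absolute moment
of order `q ∈ (1, 2]`. -/
theorem measureReal_pi_sum_deviation_le {q : ℝ} (hφ : Measurable φ) (hq1 : 1 < q) (hq2 : q ≤ 2)
    (hint : Integrable (fun y => |φ y| ^ q) ν) : ∃ K : ℝ, 0 ≤ K ∧ ∀ n : ℕ, ∀ t : ℝ, 0 < t →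
      (Measure.pi fun _ : Fin n => ν).real {y | t < |∑ i, φ (y i) - n * ∫ z, φ z ∂ν|} ≤
        K * n * t ^ (-q) := by
  set A := ∫ y, |φ y| ^ q ∂ν with hA
  have hA0 : 0 ≤ A := integral_nonneg fun y => by positivity
  -- A summand exceeding `t` costs one unit `n * A * t ^ (-q)` and Chebyshev at `t / 2` costs four;
  -- 7 leaves slack.
  refine ⟨7 * A, by positivity, fun n t ht => ?_⟩
  set P := Measure.pi fun _ : Fin n => ν with hP
  have htq : (0 : ℝ) < t ^ (-q) := by positivity
  have hφi := integrable_of_integrable_abs_rpow hφ hq1 hint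
  set ψ : Y → ℝ := {y | |φ y| ≤ t}.indicator φ with hψ
  have hψm : Measurable ψ := hφ.indicator (measurableSet_le hφ.abs measurable_const)
  have hψb : ∀ y, |ψ y| ≤ t := fun y => by
    by_cases hy : |φ y| ≤ t
    · rw [hψ, Set.indicator_of_mem (by exact hy)]; exact hy
    · rw [hψ, Set.indicator_of_notMem (by exact hy), abs_zero]; exact ht.le
  have hψL : MemLp ψ 2 ν := MemLp.of_bound hψm.aestronglyMeasurable t
    (Eventually.of_forall hψb)
  have hψi : Integrable ψ ν := hψL.integrable (by norm_num)
  have hbias : |∫ y, ψ y ∂ν - ∫ y, φ y ∂ν| ≤ A * t ^ (1 - q) := by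
    rw [abs_sub_comm, ← integral_sub hφi hψi, mul_comm, hA, ← integral_const_mul]
    exact (abs_integral_le_integral_abs).trans
      (integral_mono (hφi.sub hψi).abs (hint.const_mul _) (abs_sub_indicator_le hq1 ht))
  -- In this case the claimed bound exceeds 1. Otherwise the total truncation bias is at most `t /
  -- 2`, leaving `t / 2` for the fluctuations.
  by_cases hbig : 1 / 2 < n * A * t ^ (-q)
  · calc P.real _ ≤ 1 := measureReal_le_one
      _ ≤ 7 * A * n * t ^ (-q) := by nlinarith
  push Not at hbig
  have hsub : {y : Fin n → Y | t < |∑ i, φ (y i) - n * ∫ z, φ z ∂ν|} ⊆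
      (⋃ i : Fin n, {y | t < |φ (y i)|}) ∪
        {y | t / 2 ≤ |∑ i, ψ (y i) - n * ∫ z, ψ z ∂ν|} := by
    intro y hy
    by_contra hc
    simp only [Set.mem_union, Set.mem_iUnion, Set.mem_ofPred_eq, not_or, not_exists, not_lt,
      not_le] at hc hy
    obtain ⟨h1, h2⟩ := hc
    have h3 : ∑ i, ψ (y i) = ∑ i, φ (y i) := Finset.sum_congr rfl fun i _ => by
      rw [hψ, Set.indicator_of_mem (by exact h1 i)]
    rw [h3] at h2
    have h4 : n * |∫ y, ψ y ∂ν - ∫ y, φ y ∂ν| ≤ t / 2 := by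
      calc (n : ℝ) * |∫ y, ψ y ∂ν - ∫ y, φ y ∂ν| ≤ n * (A * t ^ (1 - q)) := by gcongr
        _ = (n * A * t ^ (-q)) * t := by
          rw [sub_eq_add_neg, Real.rpow_add ht, Real.rpow_one]; ring
        _ ≤ 1 / 2 * t := by gcongr
        _ = t / 2 := by ring
    have h5 : |∑ i, φ (y i) - n * ∫ z, φ z ∂ν| ≤ |∑ i, φ (y i) - n * ∫ z, ψ z ∂ν| +
        n * |∫ y, ψ y ∂ν - ∫ y, φ y ∂ν| := by
      have : ∑ i, φ (y i) - n * ∫ z, φ z ∂ν = (∑ i, φ (y i) - n * ∫ z, ψ z ∂ν) +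
        n * (∫ y, ψ y ∂ν - ∫ y, φ y ∂ν) := by ring
      rw [this]
      refine (abs_add_le _ _).trans ?_
      rw [abs_mul, Nat.abs_cast]
    linarith
  have hlarge : P.real (⋃ i : Fin n, {y | t < |φ (y i)|}) ≤ n * (A * t ^ (-q)) := by
    refine (measureReal_iUnion_fintype_le _).trans ?_
    have : ∀ i : Fin n, P.real {y | t < |φ (y i)|} ≤ A * t ^ (-q) := fun i => by
      have h1 : P.real {y | t < |φ (y i)|} = ν.real {z | t < |φ z|} :=
        (measurePreserving_eval (fun _ : Fin n => ν) i).measureReal_preimage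
          (measurableSet_lt measurable_const hφ.abs).nullMeasurableSet
      rw [h1, Real.rpow_neg ht.le, ← div_eq_mul_inv]
      refine le_trans ?_ (measureReal_lt_le_integral_div hint (fun y => by positivity)
        (by positivity : 0 < t ^ q))
      refine measureReal_mono fun z hz => ?_
      exact Real.rpow_lt_rpow ht.le hz (by linarith)
    calc _ ≤ ∑ i : Fin n, A * t ^ (-q) := Finset.sum_le_sum fun i _ => this i
      _ = _ := by simp
  have hcheb : P.real {y | t / 2 ≤ |∑ i, ψ (y i) - n * ∫ z, ψ z ∂ν|} ≤
      4 * (n * (A * t ^ (-q))) := by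
    have hL : MemLp (∑ i : Fin n, fun y : Fin n → Y => ψ (y i)) 2 P :=
      memLp_finsetSum' _ fun i _ =>
        hψL.comp_measurePreserving (measurePreserving_eval (fun _ : Fin n => ν) i)
    have hmean : P[∑ i : Fin n, fun y : Fin n → Y => ψ (y i)] = n * ∫ z, ψ z ∂ν := by
      rw [← integral_pi_sum n hψi]
      simp [hP]
    have h1 := meas_ge_le_variance_div_sq hL (half_pos ht)
    rw [hmean] at h1
    have h2 : Var[∑ i : Fin n, fun y : Fin n → Y => ψ (y i); P] ≤ n * (t ^ (2 - q) * A) := by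
      rw [hP, variance_sum_pi fun _ => hψL]
      have : Var[ψ; ν] ≤ t ^ (2 - q) * A := by
        refine (variance_le_expectation_sq hψm.aestronglyMeasurable).trans ?_
        rw [hA, ← integral_const_mul]
        exact integral_mono hψL.integrable_sq (hint.const_mul _) (sq_indicator_le hq2 ht)
      calc _ ≤ ∑ i : Fin n, t ^ (2 - q) * A := Finset.sum_le_sum fun i _ => this
        _ = _ := by simp
    have h3 : P.real {y | t / 2 ≤ |∑ i, ψ (y i) - n * ∫ z, ψ z ∂ν|} ≤
        Var[∑ i : Fin n, fun y : Fin n → Y => ψ (y i); P] / (t / 2) ^ 2 := by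
      refine ENNReal.toReal_le_of_le_ofReal (div_nonneg (variance_nonneg _ _) (by positivity)) ?_
      simpa using h1
    calc _ ≤ _ := h3
      _ ≤ n * (t ^ (2 - q) * A) / (t / 2) ^ 2 := by gcongr
      _ = 4 * (n * (A * t ^ (-q))) := by
        rw [sub_eq_add_neg, Real.rpow_add ht, Real.rpow_ofNat]
        field_simp
        norm_num
  calc P.real _ ≤ _ := measureReal_mono hsub
    _ ≤ _ := measureReal_union_le _ _
    _ ≤ n * (A * t ^ (-q)) + 4 * (n * (A * t ^ (-q))) := add_le_add hlarge hcheb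
    _ ≤ 7 * A * n * t ^ (-q) := by
      have : 0 ≤ n * (A * t ^ (-q)) := by positivity
      linarith

end Deviation

/-! ### Resampling a single draw. -/

theorem measurePreserving_update {X : Type*} [MeasurableSpace X] (ν : Measure X)
    [IsProbabilityMeasure ν] (m : ℕ) :
    MeasurePreserving (fun p : (ℕ → X) × X => Function.update p.1 m p.2)
      ((Measure.infinitePi fun _ : ℕ => ν).prod ν) (Measure.infinitePi fun _ : ℕ => ν) := by
  have hmeas : Measurable fun p : (ℕ → X) × X => Function.update p.1 m p.2 := by
    refine measurable_pi_lambda _ fun j => ?_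
    by_cases h : j = m
    · subst h; simpa using measurable_snd
    · simp only [Function.update_of_ne h]; fun_prop
  refine ⟨hmeas, Measure.eq_infinitePi _ fun s t ht => ?_⟩
  rw [Measure.map_apply hmeas (.pi s.countable_toSet fun _ _ => ht _)]
  by_cases hm : m ∈ s
  · have : (fun p : (ℕ → X) × X => Function.update p.1 m p.2) ⁻¹' (Set.pi s t) =
        (Set.pi (s.erase m : Finset ℕ) t) ×ˢ t m := by
      ext ⟨ω, x⟩
      simp only [Set.mem_preimage, Set.mem_pi, Finset.mem_coe, Set.mem_prod, Finset.mem_erase]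
      constructor
      · intro h
        refine ⟨fun j hj => ?_, ?_⟩
        · simpa [Function.update_of_ne hj.1] using h j hj.2
        · simpa using h m hm
      · rintro ⟨h1, h2⟩ j hj
        by_cases hjm : j = m
        · subst hjm; simpa using h2
        · simpa [Function.update_of_ne hjm] using h1 j ⟨hjm, hj⟩
    rw [this, Measure.prod_prod, Measure.infinitePi_pi _ fun i _ => ht i,
      Finset.prod_erase_mul _ _ hm]
  · have : (fun p : (ℕ → X) × X => Function.update p.1 m p.2) ⁻¹' (Set.pi s t) =
        (Set.pi s t) ×ˢ Set.univ := by
      ext ⟨ω, x⟩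
      simp only [Set.mem_preimage, Set.mem_pi, Finset.mem_coe, Set.mem_prod, Set.mem_univ,
        and_true]
      refine forall₂_congr fun j hj => ?_
      rw [Function.update_of_ne (by rintro rfl; exact hm hj)]
    rw [this, Measure.prod_prod, Measure.infinitePi_pi _ fun i _ => ht i, measure_univ, mul_one]

section Resampling
variable {X : Type*} [Finite X] [Nonempty X] [MeasurableSpace X] [DiscreteMeasurableSpace X]

theorem measurable_of_prefix {Y : Type*} [MeasurableSpace Y] {m : ℕ} {F : (ℕ → X) → Y}
    (hF : ∀ ω ω' : ℕ → X, (∀ j < m, ω j = ω' j) → F ω = F ω') : Measurable F := by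
  let x₀ : X := Classical.arbitrary X
  have : F = (fun g : Fin m → X => F fun j => if h : j < m then g ⟨j, h⟩ else x₀) ∘
      fun ω (i : Fin m) => ω i := by
    funext ω
    exact hF _ _ fun j hj => by simp [hj]
  rw [this]
  exact Measurable.of_discrete.comp (by fun_prop)

variable (ν : Measure X) [IsProbabilityMeasure ν]

/-- A draw is independent of the draws before it. -/
theorem lintegral_draw {m : ℕ} {F : (ℕ → X) → X → ℝ≥0∞}
    (hF : ∀ ω ω' : ℕ → X, (∀ j < m, ω j = ω' j) → F ω = F ω') :
    ∫⁻ ω, F ω (ω m) ∂(Measure.infinitePi fun _ : ℕ => ν) =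
      ∫⁻ ω, ∫⁻ x, F ω x ∂ν ∂(Measure.infinitePi fun _ : ℕ => ν) := by
  have hm : Measurable fun ω : ℕ → X => F ω (ω m) :=
    measurable_of_prefix (m := m + 1) fun ω ω' h => by
      rw [hF ω ω' fun j hj => h j (by lia), h m (by lia)]
  have hF' : Measurable F := measurable_of_prefix hF
  have hm2 : Measurable fun p : (ℕ → X) × X => F p.1 p.2 :=
    measurable_from_prod_countable_left fun x => (measurable_pi_apply x).comp hF'
  -- Replacing draw `m` by an independent copy preserves the law of the sequence, and `F` sees only
  -- the earlier draws, which are unaffected.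
  rw [← (measurePreserving_update ν m).lintegral_comp hm, ← lintegral_prod _ hm2.aemeasurable]
  refine lintegral_congr fun p => ?_
  rw [Function.update_self, hF (Function.update p.1 m p.2) p.1 fun j hj =>
    Function.update_of_ne (by lia) _ _]

end Resampling

/-! ### The size-biased law of the node of a uniform stub. -/

section Stubs
variable {n : ℕ} (D : Fin n → ℕ)

instance : DiscreteMeasurableSpace (OutStub D) where
  forall_measurableSet s := by
    rw [Sigma.instMeasurableSpace, MeasurableSpace.measurableSet_iInf]
    exact fun i => MeasurableSet.of_discrete (α := Fin (D i))

variable {D}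

theorem nonempty_outStub (hD : 0 < ∑ i, D i) : Nonempty (OutStub D) := by
  obtain ⟨i, -, hi⟩ := Finset.exists_ne_zero_of_sum_ne_zero hD.ne'
  exact ⟨⟨i, ⟨0, Nat.pos_of_ne_zero hi⟩⟩⟩

theorem isProbabilityMeasure_uniformOn_outStub (hD : 0 < ∑ i, D i) :
    IsProbabilityMeasure (uniformOn (Set.univ : Set (OutStub D))) :=
  have := nonempty_outStub hD
  isProbabilityMeasure_uniformOn Set.finite_univ Set.univ_nonempty

theorem lintegral_uniformOn_outStub (g : Fin n → ℝ≥0∞) :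
    ∫⁻ s, g s.1 ∂(uniformOn (Set.univ : Set (OutStub D))) =
      (∑ i, (D i : ℝ≥0∞) * g i) / ((∑ i, D i : ℕ) : ℝ≥0∞) := by
  rw [uniformOn, ProbabilityTheory.cond, lintegral_smul_measure, Measure.restrict_univ,
    lintegral_count, tsum_fintype, Fintype.sum_sigma, Measure.count_univ]
  simp only [Finset.sum_const, Finset.card_univ, Fintype.card_fin, nsmul_eq_mul]
  rw [ENNReal.div_eq_inv_mul, smul_eq_mul, ENat.card_eq_coe_fintype_card, Fintype.card_sigma]
  simp only [Fintype.card_fin, ENat.toENNReal_coe]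

end Stubs

/-! ### Exploration for fixed degrees and a fixed root. -/

section Exploration
variable {n : ℕ} (d : Degrees n) (root : Fin n)

theorem explore_congr {m : ℕ} {ω ω' : ℕ → OutStub d.2} (h : ∀ j < m, ω j = ω' j) :
    explore d root ω m = explore d root ω' m := by
  induction m with
  | zero => rfl
  | succ m ih => rw [explore, explore, ih fun j hj => h j (by lia), h m (by lia)]

/-- A draw changes labels only at the node that it hits. Thus a bad draw is a coincidence of nodes,
an event that no longer involves the state of the exploration. -/
theorem fst_mem_of_label_ne_one {ω : ℕ → OutStub d.2} {m : ℕ} {t : OutStub d.2}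
    (ht : (explore d root ω m).label t ≠ StubLabel.one) :
    t.1 = root ∨ ∃ j < m, t.1 = (ω j).1 := by
  induction m generalizing t with
  | zero =>
    left
    by_contra h
    exact ht (if_neg h)
  | succ m ih =>
    by_cases hs : t.1 = (ω m).1
    · exact Or.inr ⟨m, by lia, hs⟩
    have hne : t ≠ ω m := fun h => hs (by rw [h])
    have : (explore d root ω m).label t ≠ StubLabel.one := by
      intro hone
      apply ht
      rw [explore, Exploration.step]
      split
      · exact hone
      · split <;> simp [hs, hne, hone]
    rcases ih this with h | ⟨j, hj, h⟩
    · exact Or.inl h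
    · exact Or.inr ⟨j, by lia, h⟩

/-- Breadth-first order: generations are nondecreasing along the queue. The spread of at most one is
what makes the induction close, since stubs of generation `r + 1` are appended. -/
theorem pairwise_step (e : Exploration d.2) (s : OutStub d.2)
    (he : e.pending.Pairwise fun x y => x.2 ≤ y.2 ∧ y.2 ≤ x.2 + 1) :
    (e.step d s).pending.Pairwise fun x y => x.2 ≤ y.2 ∧ y.2 ≤ x.2 + 1 := by
  rw [Exploration.step]
  split
  · exact he
  · rename_i i r rest hp
    rw [hp, List.pairwise_cons] at he
    split
    · refine List.pairwise_append.2 ⟨he.2, ?_, fun x hx y hy => ?_⟩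
      · exact List.pairwise_replicate.2 (Or.inr ⟨le_rfl, by lia⟩)
      · rw [List.eq_of_mem_replicate hy]
        have := he.1 x hx
        exact ⟨this.2, by simpa using this.1⟩
    · exact he.2
    · simpa [hp] using he

theorem pairwise_pending (ω : ℕ → OutStub d.2) (m : ℕ) :
    (explore d root ω m).pending.Pairwise fun x y => x.2 ≤ y.2 ∧ y.2 ≤ x.2 + 1 := by
  induction m with
  | zero => exact List.pairwise_replicate.2 (Or.inr ⟨le_rfl, by lia⟩)
  | succ m ih => exact pairwise_step d _ _ ih

theorem forall_le_generation_step (e : Exploration d.2) (s : OutStub d.2) {g : ℕ}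
    (he : ∀ x ∈ e.pending, g ≤ x.2) : ∀ x ∈ (e.step d s).pending, g ≤ x.2 := by
  rw [Exploration.step]
  split
  · exact he
  · rename_i i r rest hp
    rw [hp, List.forall_mem_cons] at he
    split
    · intro x hx
      rcases List.mem_append.1 hx with h | h
      · exact he.2 x h
      · rw [List.eq_of_mem_replicate h]
        exact he.1.trans (Nat.le_succ r)
    · exact he.2
    · simpa [hp] using he

theorem step_of_pending_eq_nil {e : Exploration d.2} (s : OutStub d.2) (he : e.pending = []) :
    e.step d s = e := by
  rw [Exploration.step, he]

/-- The next draw is made for an inbound stub of a node of generation at most `k`. -/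
def DrawsWithin (ω : ℕ → OutStub d.2) (k m : ℕ) : Prop :=
  ∃ x, (explore d root ω m).pending.head? = some x ∧ x.2 ≤ k

/-- The generation at the head of the queue never decreases and an empty queue stays empty, so the
draws made within the first `k` generations form an initial segment. -/
theorem DrawsWithin.of_succ {ω : ℕ → OutStub d.2} {k m : ℕ}
    (h : DrawsWithin d root ω k (m + 1)) : DrawsWithin d root ω k m := by
  obtain ⟨x, hx, hxk⟩ := h
  rw [DrawsWithin]
  cases hp : (explore d root ω m).pending with
  | nil => rw [explore, step_of_pending_eq_nil d _ hp, hp] at hx; simp at hx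
  | cons y rest =>
    refine ⟨y, rfl, le_trans ?_ hxk⟩
    have hpw := pairwise_pending d root ω m
    rw [hp, List.pairwise_cons] at hpw
    refine forall_le_generation_step d (explore d root ω m) (ω m) (g := y.2) ?_ x
      (List.mem_of_mem_head? hx)
    rw [hp, List.forall_mem_cons]
    exact ⟨le_rfl, fun z hz => (hpw.1 z hz).1⟩

theorem DrawsWithin.anti {ω : ℕ → OutStub d.2} {k m m' : ℕ} (hm : m ≤ m')
    (h : DrawsWithin d root ω k m') : DrawsWithin d root ω k m := by
  induction hm with
  | refl => exact h
  | step _ ih => exact ih (h.of_succ d root)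

/-- None of the first `m` draws yields a stub with label `two` or `three`. -/
def NoBadDraw (ω : ℕ → OutStub d.2) (m : ℕ) : Prop :=
  ∀ m' < m, ∀ r, ¬ BadDraw d root ω m' r

theorem exists_couplingBreaks_of_tau_le {ω : ℕ → OutStub d.2} {k : ℕ}
    (h : tau d root ω ≤ (k : ℕ∞)) : ∃ m r : ℕ, CouplingBreaks d root ω m r ∧ r ≤ k := by
  have hne : {x : ℕ∞ | ∃ m r : ℕ, CouplingBreaks d root ω m r ∧ x = (r : ℕ∞)}.Nonempty := by
    by_contra hc
    rw [Set.not_nonempty_iff_eq_empty] at hc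
    rw [tau, hc, sInf_empty] at h
    exact absurd h (by simp)
  obtain ⟨m, r, hmr, hr⟩ := csInf_mem hne
  refine ⟨m, r, hmr, ?_⟩
  rw [tau, hr] at h
  exact_mod_cast h

theorem tau_le_subset (k x : ℕ) : {ω | tau d root ω ≤ (k : ℕ∞)} ⊆
    (⋃ m ∈ Finset.range x, ({ω : ℕ → OutStub d.2 | (ω m).1 = root} ∪
      ⋃ j ∈ Finset.range m, {ω | (ω m).1 = (ω j).1})) ∪
    {ω | ∀ m < x, NoBadDraw d root ω m ∧ DrawsWithin d root ω k m} := by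
  intro ω hω
  obtain ⟨m, r, ⟨⟨⟨i, hi⟩, hlabel⟩, hfirst⟩, hr⟩ := exists_couplingBreaks_of_tau_le d root hω
  by_cases hm : m < x
  · left
    refine Set.mem_biUnion (Finset.mem_coe.2 (Finset.mem_range.2 hm)) ?_
    rcases fst_mem_of_label_ne_one d root hlabel with h | ⟨j, hj, h⟩
    · exact Or.inl h
    · exact Or.inr (Set.mem_biUnion (Finset.mem_coe.2 (Finset.mem_range.2 hj)) h)
  · right
    intro m' hm'
    exact ⟨fun m'' h'' => hfirst m'' (by lia),
      DrawsWithin.anti d root (by lia : m' ≤ m) ⟨(i, r), hi, hr⟩⟩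

theorem noBadDraw_congr {m : ℕ} {ω ω' : ℕ → OutStub d.2} (h : ∀ j < m, ω j = ω' j) :
    NoBadDraw d root ω m = NoBadDraw d root ω' m := by
  simp only [NoBadDraw, BadDraw]
  refine propext (forall₂_congr fun m' hm' => ?_)
  rw [explore_congr d root fun j hj => h j (by lia), h m' hm']

theorem drawsWithin_congr {k m : ℕ} {ω ω' : ℕ → OutStub d.2} (h : ∀ j < m, ω j = ω' j) :
    DrawsWithin d root ω k m = DrawsWithin d root ω' k m := by
  simp only [DrawsWithin, explore_congr d root h]

/-- The mean number of draws made in the first `k` generations for an inbound stub of generation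
`r` and its descendants, in a branching tree with offspring mean `M`. -/
noncomputable def drawWeight (M : ℝ≥0∞) (k r : ℕ) : ℝ≥0∞ := ∑ j ∈ Finset.range (k + 1 - r), M ^ j

/-- One draw for the stub itself, then on average `M` inbound stubs one generation later. Truncated
subtraction gives weight 0 beyond generation `k`. -/
theorem drawWeight_of_le (M : ℝ≥0∞) {k r : ℕ} (hr : r ≤ k) :
    drawWeight M k r = M * drawWeight M k (r + 1) + 1 := by
  rw [drawWeight, drawWeight, show k + 1 - r = (k + 1 - (r + 1)) + 1 by lia,
    Finset.sum_range_succ', pow_zero, Finset.mul_sum]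
  simp only [pow_succ']

theorem drawWeight_of_lt (M : ℝ≥0∞) {k r : ℕ} (hr : k < r) : drawWeight M k r = 0 := by
  rw [drawWeight, show k + 1 - r = 0 by lia, Finset.sum_range_zero]

/-- The total weight of the unpaired inbound stubs. -/
noncomputable def queueWeight (M : ℝ≥0∞) (k : ℕ) (l : List (Fin n × ℕ)) : ℝ≥0∞ :=
  (l.map fun x => drawWeight M k x.2).sum

open Classical in
/-- Average over one draw: the total weight drops by at least one in every draw made within the
first `k` generations. -/
theorem lintegral_queueWeight_step_le {M : ℝ≥0∞} (hD : 0 < ∑ i, d.2 i)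
    (hM : ∫⁻ s, (d.1 s.1 : ℝ≥0∞) ∂(uniformOn (Set.univ : Set (OutStub d.2))) ≤ M)
    (e : Exploration d.2) (k : ℕ) :
    ∫⁻ s, (if e.pending = [] ∨ e.label s = StubLabel.one then
        queueWeight M k (e.step d s).pending else 0)
        ∂(uniformOn (Set.univ : Set (OutStub d.2))) +
      (if ∃ x, e.pending.head? = some x ∧ x.2 ≤ k then 1 else 0) ≤ queueWeight M k e.pending := by
  have := isProbabilityMeasure_uniformOn_outStub hD
  cases hp : e.pending with
  | nil => simp [step_of_pending_eq_nil d _ hp, hp, queueWeight]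
  | cons y rest =>
    -- Only draws with label `one` are kept: a redraw after label `three` would leave the weight
    -- unchanged and spoil the decrease.
    have hstep : ∀ s, (if y :: rest = [] ∨ e.label s = StubLabel.one then
        queueWeight M k (e.step d s).pending else 0) ≤
        queueWeight M k rest + d.1 s.1 * drawWeight M k (y.2 + 1) := by
      intro s
      by_cases hs : y :: rest = [] ∨ e.label s = StubLabel.one
      · rw [if_pos hs]
        have hs1 : e.label s = StubLabel.one := by simpa using hs
        have : (e.step d s).pending = rest ++ List.replicate (d.1 s.1) (s.1, y.2 + 1) := by
          rw [Exploration.step]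
          simp only [hp, hs1]
        rw [this]
        simp [queueWeight]
      · rw [if_neg hs]
        exact zero_le
    calc _ ≤ ∫⁻ s, (queueWeight M k rest + d.1 s.1 * drawWeight M k (y.2 + 1))
          ∂(uniformOn (Set.univ : Set (OutStub d.2))) +
          (if ∃ x, (y :: rest).head? = some x ∧ x.2 ≤ k then 1 else 0) :=
        add_le_add (lintegral_mono hstep) le_rfl
      _ ≤ queueWeight M k rest + M * drawWeight M k (y.2 + 1) + (if y.2 ≤ k then 1 else 0) := by
        rw [lintegral_add_left measurable_const, lintegral_const, measure_univ, mul_one,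
          lintegral_mul_const _ Measurable.of_discrete]
        gcongr
        simp
      _ ≤ queueWeight M k (y :: rest) := by
        have hc : queueWeight M k (y :: rest) = drawWeight M k y.2 + queueWeight M k rest := by
          simp [queueWeight]
        rw [hc]
        by_cases hk : y.2 ≤ k
        · rw [drawWeight_of_le M hk, if_pos hk, add_assoc, add_comm]
        · rw [drawWeight_of_lt M (by lia : k < y.2 + 1), if_neg hk]
          simp

open Classical in
-- The supermartingale step: `lintegral_draw` averages over draw `m` with the past frozen, and
-- `lintegral_queueWeight_step_le` applies to the frozen state.
theorem lintegral_queueWeight_succ_le {M : ℝ≥0∞} (hD : 0 < ∑ i, d.2 i)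
    (hM : ∫⁻ s, (d.1 s.1 : ℝ≥0∞) ∂(uniformOn (Set.univ : Set (OutStub d.2))) ≤ M) (k m : ℕ) :
    ∫⁻ ω, (if NoBadDraw d root ω (m + 1) then
        queueWeight M k (explore d root ω (m + 1)).pending else 0) ∂(drawLaw d.2) +
      drawLaw d.2 {ω | NoBadDraw d root ω m ∧ DrawsWithin d root ω k m} ≤
    ∫⁻ ω, (if NoBadDraw d root ω m then
        queueWeight M k (explore d root ω m).pending else 0) ∂(drawLaw d.2) := by
  have := isProbabilityMeasure_uniformOn_outStub hD
  have := nonempty_outStub hD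
  set F : (ℕ → OutStub d.2) → OutStub d.2 → ℝ≥0∞ := fun ω s =>
    if NoBadDraw d root ω m then (if (explore d root ω m).pending = [] ∨
      (explore d root ω m).label s = StubLabel.one then
        queueWeight M k ((explore d root ω m).step d s).pending else 0) else 0 with hFdef
  have hF : ∀ ω ω' : ℕ → OutStub d.2, (∀ j < m, ω j = ω' j) → F ω = F ω' := fun ω ω' h => by
    simp only [hFdef, explore_congr d root h, noBadDraw_congr d root h]
  have h1 : ∫⁻ ω, (if NoBadDraw d root ω (m + 1) then
        queueWeight M k (explore d root ω (m + 1)).pending else 0) ∂(drawLaw d.2) ≤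
      ∫⁻ ω, F ω (ω m) ∂(drawLaw d.2) := by
    refine lintegral_mono fun ω => ?_
    simp only [hFdef]
    by_cases hgood : NoBadDraw d root ω (m + 1)
    · have hgood' : NoBadDraw d root ω m := fun m' hm' => hgood m' (by lia)
      rw [if_pos hgood, if_pos hgood', if_pos, explore]
      cases hp : (explore d root ω m).pending with
      | nil => exact Or.inl rfl
      | cons y rest =>
        right
        by_contra hne
        exact hgood m (by lia) y.2 ⟨⟨y.1, by rw [hp]; rfl⟩, hne⟩
    · rw [if_neg hgood]
      exact zero_le
  have h2 : ∫⁻ ω, F ω (ω m) ∂(drawLaw d.2) = ∫⁻ ω, ∫⁻ s, F ω s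
      ∂(uniformOn (Set.univ : Set (OutStub d.2))) ∂(drawLaw d.2) := lintegral_draw _ hF
  have hset : MeasurableSet {ω | NoBadDraw d root ω m ∧ DrawsWithin d root ω k m} :=
    measurableSet_setOfPred.2 (measurable_of_prefix (m := m) fun ω ω' h => by
      rw [noBadDraw_congr d root h, drawsWithin_congr d root h])
  rw [← lintegral_indicator_one hset]
  calc _ ≤ _ := add_le_add (h1.trans_eq h2) le_rfl
    _ = _ := (lintegral_add_right _ (measurable_one.indicator hset)).symm
    _ ≤ _ := lintegral_mono fun ω => ?_
  by_cases hgood : NoBadDraw d root ω m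
  · have := lintegral_queueWeight_step_le d hD hM (explore d root ω m) k
    simpa [hFdef, hgood, Set.indicator_apply, DrawsWithin] using this
  · simp [hFdef, hgood]

/-- Telescoping the one-step decrease: the expected number of draws is paid for by the initial
weight of the queue. -/
theorem sum_measure_drawsWithin_le {M : ℝ≥0∞} (hD : 0 < ∑ i, d.2 i)
    (hM : ∫⁻ s, (d.1 s.1 : ℝ≥0∞) ∂(uniformOn (Set.univ : Set (OutStub d.2))) ≤ M) (k x : ℕ) :
    ∑ m ∈ Finset.range x, drawLaw d.2 {ω | NoBadDraw d root ω m ∧ DrawsWithin d root ω k m} ≤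
      d.1 root * drawWeight M k 0 := by
  classical
  have := isProbabilityMeasure_uniformOn_outStub hD
  have hprob : IsProbabilityMeasure (drawLaw d.2) := by unfold drawLaw; infer_instance
  suffices h : ∫⁻ ω, (if NoBadDraw d root ω x then
        queueWeight M k (explore d root ω x).pending else 0) ∂(drawLaw d.2) +
      ∑ m ∈ Finset.range x,
        drawLaw d.2 {ω | NoBadDraw d root ω m ∧ DrawsWithin d root ω k m} ≤
      d.1 root * drawWeight M k 0 from le_trans le_add_self h
  induction x with
  | zero =>
    have : ∀ ω, NoBadDraw d root ω 0 := fun ω m hm => absurd hm (by lia)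
    simp [this, explore, Exploration.init, queueWeight]
  | succ x ih =>
    rw [Finset.sum_range_succ]
    refine le_trans ?_ ih
    have := lintegral_queueWeight_succ_le d root hD hM k x
    rw [add_comm (∑ m ∈ Finset.range x, _), ← add_assoc]
    gcongr

theorem measure_forall_drawsWithin_le {M : ℝ≥0∞} (hD : 0 < ∑ i, d.2 i)
    (hM : ∫⁻ s, (d.1 s.1 : ℝ≥0∞) ∂(uniformOn (Set.univ : Set (OutStub d.2))) ≤ M) (k : ℕ) {x : ℕ}
    (hx : 0 < x) :
    drawLaw d.2 {ω | ∀ m < x, NoBadDraw d root ω m ∧ DrawsWithin d root ω k m} ≤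
      d.1 root * drawWeight M k 0 / x := by
  rw [ENNReal.le_div_iff_mul_le (Or.inl (by exact_mod_cast hx.ne')) (Or.inl (by simp))]
  refine le_trans ?_ (sum_measure_drawsWithin_le d root hD hM k x)
  rw [mul_comm, ← nsmul_eq_mul]
  have := Finset.card_nsmul_le_sum (Finset.range x)
    (fun m => drawLaw d.2 {ω | NoBadDraw d root ω m ∧ DrawsWithin d root ω k m})
    (drawLaw d.2 {ω | ∀ m < x, NoBadDraw d root ω m ∧ DrawsWithin d root ω k m})
    fun m hm => measure_mono fun ω hω => hω m (Finset.mem_range.1 hm)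
  rwa [Finset.card_range] at this

/-! ### Probabilities of coincidences and the resulting coupling bound. -/

theorem measure_draw_eq_root (hD : 0 < ∑ i, d.2 i) (m : ℕ) :
    drawLaw d.2 {ω | (ω m).1 = root} = d.2 root / ((∑ i, d.2 i : ℕ) : ℝ≥0∞) := by
  classical
  have := isProbabilityMeasure_uniformOn_outStub hD
  have h1 := (measurePreserving_eval_infinitePi
    (fun _ : ℕ => uniformOn (Set.univ : Set (OutStub d.2))) m).measure_preimage
    (s := {s | s.1 = root}) MeasurableSet.of_discrete.nullMeasurableSet
  refine h1.trans ?_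
  have h2 := lintegral_uniformOn_outStub (D := d.2) (fun i => if i = root then 1 else 0)
  rw [← lintegral_indicator_one MeasurableSet.of_discrete]
  simpa [Set.indicator_apply] using h2

theorem measure_draw_eq_draw (hD : 0 < ∑ i, d.2 i) {j m : ℕ} (hj : j < m) :
    drawLaw d.2 {ω | (ω m).1 = (ω j).1} =
      (∑ i, (d.2 i : ℝ≥0∞) ^ 2) / ((∑ i, d.2 i : ℕ) : ℝ≥0∞) ^ 2 := by
  classical
  have := isProbabilityMeasure_uniformOn_outStub hD
  have := nonempty_outStub hD
  have hset : MeasurableSet {ω : ℕ → OutStub d.2 | (ω m).1 = (ω j).1} :=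
    measurableSet_setOfPred.2 (measurable_of_prefix (m := m + 1) fun ω ω' h => by
      rw [h m (by lia), h j (by lia)])
  have h1 : ∫⁻ ω, (if (ω m).1 = (ω j).1 then 1 else 0) ∂(drawLaw d.2) =
      ∫⁻ ω, ∫⁻ s, (if s.1 = (ω j).1 then 1 else 0)
        ∂(uniformOn (Set.univ : Set (OutStub d.2))) ∂(drawLaw d.2) :=
    lintegral_draw _
      (F := fun (ω : ℕ → OutStub d.2) (s : OutStub d.2) => if s.1 = (ω j).1 then 1 else 0) (m := m)
      fun ω ω' h => by rw [h j hj]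
  have h2 : ∀ i : Fin n, ∫⁻ s, (if s.1 = i then 1 else 0)
        ∂(uniformOn (Set.univ : Set (OutStub d.2))) =
        d.2 i / ((∑ i, d.2 i : ℕ) : ℝ≥0∞) := fun i => by
    rw [lintegral_uniformOn_outStub (D := d.2) (fun i' => if i' = i then 1 else 0)]
    simp
  have h3 : ∫⁻ ω, (d.2 (ω j).1 : ℝ≥0∞) / ((∑ i, d.2 i : ℕ) : ℝ≥0∞) ∂(drawLaw d.2) =
      ∫⁻ s, (d.2 s.1 : ℝ≥0∞) / ((∑ i, d.2 i : ℕ) : ℝ≥0∞)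
        ∂(uniformOn (Set.univ : Set (OutStub d.2))) :=
    (measurePreserving_eval_infinitePi
      (fun _ : ℕ => uniformOn (Set.univ : Set (OutStub d.2))) j).lintegral_comp
        (f := fun s => (d.2 s.1 : ℝ≥0∞) / ((∑ i, d.2 i : ℕ) : ℝ≥0∞)) Measurable.of_discrete
  have h4 := lintegral_uniformOn_outStub (D := d.2)
    (fun i => (d.2 i : ℝ≥0∞) / ((∑ i, d.2 i : ℕ) : ℝ≥0∞))
  rw [← lintegral_indicator_one hset]
  simp only [h2] at h1
  simp only [Set.indicator_apply, Pi.one_apply]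
  refine h1.trans (h3.trans (h4.trans ?_))
  simp only [div_eq_mul_inv, ← mul_assoc, ← Finset.sum_mul, sq]
  rw [mul_assoc, ENNReal.mul_inv (by simp) (by simp)]

/-- The coupling bound for a fixed bi-degree sequence and a fixed root. -/
theorem measure_tau_le_le {M : ℝ≥0∞} (hD : 0 < ∑ i, d.2 i)
    (hM : ∫⁻ s, (d.1 s.1 : ℝ≥0∞) ∂(uniformOn (Set.univ : Set (OutStub d.2))) ≤ M) (k : ℕ) {x : ℕ}
    (hx : 0 < x) : drawLaw d.2 {ω | tau d root ω ≤ (k : ℕ∞)} ≤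
      x * (d.2 root / ((∑ i, d.2 i : ℕ) : ℝ≥0∞)) +
        x ^ 2 * ((∑ i, (d.2 i : ℝ≥0∞) ^ 2) / ((∑ i, d.2 i : ℕ) : ℝ≥0∞) ^ 2) +
        d.1 root * drawWeight M k 0 / x := by
  refine (measure_mono (tau_le_subset d root k x)).trans ((measure_union_le _ _).trans ?_)
  refine add_le_add ?_ (measure_forall_drawsWithin_le d root hD hM k hx)
  refine (measure_biUnion_finset_le _ _).trans ?_
  set p := (d.2 root : ℝ≥0∞) / ((∑ i, d.2 i : ℕ) : ℝ≥0∞)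
  set c := (∑ i, (d.2 i : ℝ≥0∞) ^ 2) / ((∑ i, d.2 i : ℕ) : ℝ≥0∞) ^ 2
  -- Union bound over draws `m < x`: each may hit the root or coincide with one of its fewer than
  -- `x` predecessors.
  calc _ ≤ ∑ m ∈ Finset.range x, (p + x * c) := by
        refine Finset.sum_le_sum fun m hm => (measure_union_le _ _).trans ?_
        rw [measure_draw_eq_root d root hD]
        gcongr
        refine (measure_biUnion_finset_le _ _).trans ?_
        calc _ = ∑ j ∈ Finset.range m, c := Finset.sum_congr rfl fun j hj =>
              measure_draw_eq_draw d hD (Finset.mem_range.1 hj)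
          _ = m * c := by simp
          _ ≤ x * c := by
            gcongr
            exact (Finset.mem_range.1 hm).le
    _ = x * p + x ^ 2 * c := by simp; ring

end Exploration

/-! ### Averaging over the root. -/

section Quenched
variable {n : ℕ} (d : Degrees n)

theorem drawLaw_le_one (D : Fin n → ℕ) (s : Set (ℕ → OutStub D)) : drawLaw D s ≤ 1 := by
  by_cases h : ∀ _ : ℕ, IsProbabilityMeasure (uniformOn (Set.univ : Set (OutStub D)))
  · have : IsProbabilityMeasure (drawLaw D) := by unfold drawLaw; infer_instance
    exact prob_le_one
  · rw [drawLaw, Measure.infinitePi, dif_neg h]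
    simp

theorem average_drawLaw_le_one (s : Fin n → Set (ℕ → OutStub d.2)) :
    (n : ℝ≥0∞)⁻¹ * ∑ root, drawLaw d.2 (s root) ≤ 1 := by
  calc _ ≤ (n : ℝ≥0∞)⁻¹ * ∑ root : Fin n, 1 := by
        gcongr
        exact drawLaw_le_one _ _
    _ ≤ 1 := by simp [ENNReal.inv_mul_le_one]

theorem drawWeight_zero_le {M : ℝ} (hM : 1 < M) (k : ℕ) :
    drawWeight (ENNReal.ofReal M) k 0 ≤ ENNReal.ofReal (M ^ (k + 1) / (M - 1)) := by
  have h0 : 0 ≤ M := by linarith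
  rw [drawWeight, Nat.sub_zero]
  simp only [← ENNReal.ofReal_pow h0]
  rw [← ENNReal.ofReal_sum_of_nonneg fun j _ => by positivity, geom_sum_eq hM.ne']
  refine ENNReal.ofReal_le_ofReal ?_
  have : 0 < M - 1 := by linarith
  gcongr
  linarith

/-- The coupling bound for a fixed bi-degree sequence and a uniformly chosen root. -/
theorem average_measure_tau_le_le {M : ℝ} (hM1 : 1 < M) (hD : 0 < ∑ i, d.2 i)
    (hM : ∑ i, (d.1 i : ℝ) * d.2 i ≤ M * ∑ i, (d.2 i : ℝ)) (k : ℕ) {x : ℕ} (hx : 0 < x) :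
    (n : ℝ≥0∞)⁻¹ * ∑ root : Fin n, drawLaw d.2 {ω | tau d root ω ≤ (k : ℕ∞)} ≤
      ENNReal.ofReal ((x : ℝ) / n + x ^ 2 * ((∑ i, (d.2 i : ℝ) ^ 2) / (∑ i, (d.2 i : ℝ)) ^ 2) +
        (∑ i, (d.1 i : ℝ)) / n * (M ^ (k + 1) / (M - 1)) / x) := by
  have hn : 0 < n := by
    rcases Nat.eq_zero_or_pos n with rfl | h
    · simp at hD
    · exact h
  have hn' : (0 : ℝ) < n := by exact_mod_cast hn
  have hx' : (0 : ℝ) < x := by exact_mod_cast hx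
  set L : ℝ := ∑ i, (d.2 i : ℝ) with hL
  have hLpos : 0 < L := by rw [hL]; exact_mod_cast hD
  have hLcast : ((∑ i, d.2 i : ℕ) : ℝ≥0∞) = ENNReal.ofReal L := by
    rw [hL, ← Nat.cast_sum, ENNReal.ofReal_natCast]
  set w : ℝ := M ^ (k + 1) / (M - 1) with hw
  have hw0 : 0 ≤ w := div_nonneg (by positivity) (by linarith)
  set c : ℝ := (∑ i, (d.2 i : ℝ) ^ 2) / L ^ 2 with hc
  have hc0 : 0 ≤ c := by positivity
  have hS2 : ∑ i, (d.2 i : ℝ≥0∞) ^ 2 = ENNReal.ofReal (∑ i, (d.2 i : ℝ) ^ 2) := by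
    rw [ENNReal.ofReal_sum_of_nonneg fun i _ => by positivity]
    exact Finset.sum_congr rfl fun i _ => by
      rw [ENNReal.ofReal_pow (Nat.cast_nonneg _), ENNReal.ofReal_natCast]
  have hMe : ∫⁻ s, (d.1 s.1 : ℝ≥0∞) ∂(uniformOn (Set.univ : Set (OutStub d.2))) ≤
      ENNReal.ofReal M := by
    rw [lintegral_uniformOn_outStub (fun i => (d.1 i : ℝ≥0∞)), hLcast]
    refine ENNReal.div_le_of_le_mul ?_
    rw [← ENNReal.ofReal_mul (by linarith)]
    refine le_trans (le_of_eq ?_) (ENNReal.ofReal_le_ofReal hM)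
    rw [ENNReal.ofReal_sum_of_nonneg fun i _ => by positivity]
    refine Finset.sum_congr rfl fun i _ => ?_
    rw [ENNReal.ofReal_mul (by positivity), ENNReal.ofReal_natCast, ENNReal.ofReal_natCast,
      mul_comm]
  have hroot : ∀ root : Fin n, drawLaw d.2 {ω | tau d root ω ≤ (k : ℕ∞)} ≤
      ENNReal.ofReal (x * (d.2 root / L) + x ^ 2 * c + d.1 root * w / x) := fun root => by
    refine (measure_tau_le_le d root hD hMe k hx).trans ?_
    rw [ENNReal.ofReal_add (by positivity) (by positivity),
      ENNReal.ofReal_add (by positivity) (by positivity), hLcast]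
    refine add_le_add (add_le_add (le_of_eq ?_) (le_of_eq ?_)) ?_
    · rw [ENNReal.ofReal_mul hx'.le, ENNReal.ofReal_div_of_pos hLpos, ENNReal.ofReal_natCast,
        ENNReal.ofReal_natCast]
    · rw [ENNReal.ofReal_mul (by positivity), hc, ENNReal.ofReal_div_of_pos (by positivity),
        ENNReal.ofReal_pow hx'.le, ENNReal.ofReal_pow hLpos.le, ENNReal.ofReal_natCast, hS2]
    · rw [ENNReal.ofReal_div_of_pos hx', ENNReal.ofReal_mul (by positivity),
        ENNReal.ofReal_natCast, ENNReal.ofReal_natCast]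
      gcongr
      exact drawWeight_zero_le hM1 k
  calc _ ≤ (n : ℝ≥0∞)⁻¹ * ∑ root : Fin n,
        ENNReal.ofReal (x * (d.2 root / L) + x ^ 2 * c + d.1 root * w / x) := by
        gcongr with root
        exact hroot root
    _ = ENNReal.ofReal ((n : ℝ)⁻¹ * ∑ root : Fin n,
        (x * (d.2 root / L) + x ^ 2 * c + d.1 root * w / x)) := by
        rw [ENNReal.ofReal_mul (by positivity), ENNReal.ofReal_inv_of_pos hn',
          ENNReal.ofReal_natCast, ENNReal.ofReal_sum_of_nonneg fun i _ => by positivity]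
    _ = _ := by
        congr 1
        rw [Finset.sum_add_distrib, Finset.sum_add_distrib, ← Finset.mul_sum, ← Finset.sum_div,
          ← Finset.sum_div, ← hL, div_self hLpos.ne']
        simp only [Finset.sum_const, Finset.card_univ, Fintype.card_fin, nsmul_eq_mul, ← Finset.sum_mul]
        field_simp

end Quenched

/-! ### Effect of the added stubs on the empirical moments. -/

section Adjust
variable {n : ℕ} (p : Degrees n) (S : Finset (Fin n))

theorem sum_le_sum_adjust_snd : ∑ i, (p.2 i : ℝ) ≤ ∑ i, ((adjust p S).2 i : ℝ) := by
  refine Finset.sum_le_sum fun i _ => ?_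
  simp only [adjust]
  split_ifs <;> simp

theorem sum_adjust_fst_le : ∑ i, ((adjust p S).1 i : ℝ) ≤ ∑ i, (p.1 i : ℝ) + n := by
  have : ∑ i, ((adjust p S).1 i : ℝ) ≤ ∑ i, ((p.1 i : ℝ) + 1) := by
    refine Finset.sum_le_sum fun i _ => ?_
    simp only [adjust]
    split_ifs <;> simp
  simpa [Finset.sum_add_distrib] using this

theorem sum_sq_adjust_snd_le :
    ∑ i, ((adjust p S).2 i : ℝ) ^ 2 ≤ 2 * ∑ i, (p.2 i : ℝ) ^ 2 + 2 * n := by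
  have : ∑ i, ((adjust p S).2 i : ℝ) ^ 2 ≤ ∑ i, (2 * (p.2 i : ℝ) ^ 2 + 2) := by
    refine Finset.sum_le_sum fun i _ => ?_
    simp only [adjust]
    split_ifs
    · push_cast
      nlinarith [sq_nonneg ((p.2 i : ℝ) - 1)]
    · nlinarith [sq_nonneg (p.2 i : ℝ)]
  simpa [Finset.sum_add_distrib, Finset.mul_sum, mul_comm] using this

/-- Entries up to `T` contribute at most `T` each, and larger ones are absorbed by the moment of
order `q`. The bound depends on `S` only through its size. -/
theorem sum_subset_le {q T : ℝ} (hq : 1 ≤ q) (hT : 0 < T) (a : Fin n → ℕ) :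
    ∑ i ∈ S, (a i : ℝ) ≤ S.card * T + T ^ (1 - q) * ∑ i, (a i : ℝ) ^ q := by
  have h1 : ∀ i, (a i : ℝ) ≤ T + T ^ (1 - q) * (a i : ℝ) ^ q := fun i => by
    rcases le_total (a i : ℝ) T with h | h
    · have : 0 ≤ T ^ (1 - q) * (a i : ℝ) ^ q := by positivity
      linarith
    · have ha : (0 : ℝ) < a i := hT.trans_le h
      calc (a i : ℝ) = (a i : ℝ) ^ (1 - q) * (a i : ℝ) ^ q := by
            rw [← Real.rpow_add ha]; norm_num
        _ ≤ T ^ (1 - q) * (a i : ℝ) ^ q := by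
            gcongr ?_ * _
            exact Real.rpow_le_rpow_of_nonpos hT h (by linarith)
        _ ≤ _ := by linarith
  calc _ ≤ ∑ i ∈ S, (T + T ^ (1 - q) * (a i : ℝ) ^ q) := Finset.sum_le_sum fun i _ => h1 i
    _ = S.card * T + T ^ (1 - q) * ∑ i ∈ S, (a i : ℝ) ^ q := by
      rw [Finset.sum_add_distrib, Finset.mul_sum]; simp
    _ ≤ _ := by
      gcongr
      exact Finset.subset_univ S

/-- An extra stub on one side of a chosen node raises the sum of products by the degree on the other
side, so the increase is a degree sum over `S`. -/
theorem sum_mul_adjust_le {q T B : ℝ} (hq : 1 ≤ q) (hT : 0 < T)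
    (h1 : ∑ i, (p.1 i : ℝ) ^ q ≤ B) (h2 : ∑ i, (p.2 i : ℝ) ^ q ≤ B) :
    ∑ i, ((adjust p S).1 i : ℝ) * (adjust p S).2 i ≤
      ∑ i, (p.1 i : ℝ) * p.2 i + (S.card * T + T ^ (1 - q) * B) := by
  have hT' : 0 ≤ T ^ (1 - q) := by positivity
  by_cases he : excess p < 0
  · have : ∑ i, ((adjust p S).1 i : ℝ) * (adjust p S).2 i =
        ∑ i, (p.1 i : ℝ) * p.2 i + ∑ i ∈ S, (p.2 i : ℝ) := by
      rw [← Finset.univ_inter S, ← Finset.sum_ite_mem, ← Finset.sum_add_distrib]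
      refine Finset.sum_congr rfl fun i _ => ?_
      by_cases hi : i ∈ S <;> simp [adjust, he, hi, not_le.2 he, add_mul]
    rw [this]
    have := sum_subset_le S hq hT p.2
    nlinarith
  · have : ∑ i, ((adjust p S).1 i : ℝ) * (adjust p S).2 i =
        ∑ i, (p.1 i : ℝ) * p.2 i + ∑ i ∈ S, (p.1 i : ℝ) := by
      rw [← Finset.univ_inter S, ← Finset.sum_ite_mem, ← Finset.sum_add_distrib]
      refine Finset.sum_congr rfl fun i _ => ?_
      by_cases hi : i ∈ S <;> simp [adjust, he, hi, not_lt.1 he, mul_add]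
    rw [this]
    have := sum_subset_le S hq hT p.1
    nlinarith

end Adjust

/-! ### Averaging over the chosen nodes. -/

section AdjustLaw
variable {n : ℕ} (p : Degrees n)

theorem lintegral_adjustLaw (g : Degrees n → ℝ≥0∞) : ∫⁻ d, g d ∂(adjustLaw p) =
    ((n.choose (excess p).natAbs : ℕ) : ℝ≥0∞)⁻¹ *
      ∑ S ∈ Finset.powersetCard (excess p).natAbs (Finset.univ : Finset (Fin n)),
        g (adjust p S) := by
  rw [adjustLaw, lintegral_smul_measure, lintegral_finsetSum_measure, smul_eq_mul]
  simp only [lintegral_dirac]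

theorem lintegral_adjustLaw_le {g : Degrees n → ℝ≥0∞} {c : ℝ≥0∞}
    (hg : ∀ S : Finset (Fin n), S.card = (excess p).natAbs → g (adjust p S) ≤ c) :
    ∫⁻ d, g d ∂(adjustLaw p) ≤ c := by
  rw [lintegral_adjustLaw]
  calc _ ≤ ((n.choose (excess p).natAbs : ℕ) : ℝ≥0∞)⁻¹ *
        ∑ S ∈ Finset.powersetCard (excess p).natAbs (Finset.univ : Finset (Fin n)), c := by
        gcongr with S hS
        exact hg S (Finset.mem_powersetCard.1 hS).2
    _ ≤ c := by
        rw [Finset.sum_const, Finset.card_powersetCard, Finset.card_univ, Fintype.card_fin,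
          nsmul_eq_mul, ← mul_assoc]
        exact mul_le_of_le_one_left' (ENNReal.inv_mul_le_one _)

/-- If more than `n` nodes were requested, the sum over subsets would be empty and the law would be
zero. -/
theorem adjustLaw_univ (hp : (excess p).natAbs ≤ n) : adjustLaw p Set.univ = 1 := by
  rw [← lintegral_one, lintegral_adjustLaw, Finset.sum_const, Finset.card_powersetCard,
    Finset.card_univ, Fintype.card_fin, nsmul_eq_mul, mul_one]
  exact ENNReal.inv_mul_cancel (by simpa using (Nat.choose_pos hp).ne') (by simp)

end AdjustLaw

/-- The sequence is bounded above by a constant times a negative power of `n`. -/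
def PolyDecay (f : ℕ → ℝ) : Prop :=
  ∃ δ : ℝ, 0 < δ ∧ ∃ C : ℝ, 0 ≤ C ∧ ∀ᶠ n : ℕ in atTop, f n ≤ C * (n : ℝ) ^ (-δ)

/-! ### Closure properties of polynomial decay. -/

namespace PolyDecay

theorem add {f g : ℕ → ℝ} (hf : PolyDecay f) (hg : PolyDecay g) :
    PolyDecay fun n => f n + g n := by
  obtain ⟨a, ha, A, hA, hf⟩ := hf
  obtain ⟨b, hb, B, hB, hg⟩ := hg
  refine ⟨min a b, lt_min ha hb, A + B, add_nonneg hA hB, ?_⟩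
  filter_upwards [hf, hg, eventually_ge_atTop 1] with n h1 h2 hn
  have hn' : (1 : ℝ) ≤ n := by exact_mod_cast hn
  have ha' : (n : ℝ) ^ (-a) ≤ (n : ℝ) ^ (-min a b) :=
    Real.rpow_le_rpow_of_exponent_le hn' (neg_le_neg (min_le_left a b))
  have hb' : (n : ℝ) ^ (-b) ≤ (n : ℝ) ^ (-min a b) :=
    Real.rpow_le_rpow_of_exponent_le hn' (neg_le_neg (min_le_right a b))
  nlinarith

theorem mono {f g : ℕ → ℝ} (hf : PolyDecay f) (h : ∀ᶠ n in atTop, g n ≤ f n) : PolyDecay g := by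
  obtain ⟨a, ha, A, hA, hf⟩ := hf
  exact ⟨a, ha, A, hA, by filter_upwards [hf, h] with n h1 h2 using h2.trans h1⟩

theorem const_mul_rpow (c : ℝ) {a : ℝ} (ha : 0 < a) : PolyDecay fun n => c * (n : ℝ) ^ (-a) :=
  ⟨a, ha, |c|, abs_nonneg c, Eventually.of_forall fun n => by
    exact mul_le_mul_of_nonneg_right (le_abs_self c) (by positivity)⟩

theorem const_mul {f : ℕ → ℝ} (hf : PolyDecay f) {c : ℝ} (hc : 0 ≤ c) :
    PolyDecay fun n => c * f n := by
  obtain ⟨a, ha, A, hA, hf⟩ := hf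
  refine ⟨a, ha, c * A, by positivity, ?_⟩
  filter_upwards [hf] with n h
  rw [mul_assoc]
  gcongr

theorem eventually_lt {f : ℕ → ℝ} (hf : PolyDecay f) {ε : ℝ} (hε : 0 < ε) :
    ∀ᶠ n in atTop, f n < ε := by
  obtain ⟨a, ha, A, hA, hf⟩ := hf
  have h1 : Tendsto (fun n : ℕ => A * (n : ℝ) ^ (-a)) atTop (nhds (A * 0)) :=
    ((tendsto_rpow_neg_atTop ha).comp tendsto_natCast_atTop_atTop).const_mul A
  rw [mul_zero] at h1
  filter_upwards [hf, h1.eventually_lt_const hε] with n h2 h3 using h2.trans_lt h3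

end PolyDecay

/-! ### Deviation estimates for a single attempt. -/

section Attempt
variable {fIn fOut : PMF ℕ}

instance (n : ℕ) : IsProbabilityMeasure (attemptLaw fIn fOut n) := by
  unfold attemptLaw; infer_instance

/-- Regrouping by node makes the pairs of degrees i.i.d., so bounds for i.i.d. sums apply to
functions of a pair. -/
theorem attemptLaw_real_eq (n : ℕ) (s : Set (Fin n → ℕ × ℕ)) :
    (attemptLaw fIn fOut n).real {p | (fun i => (p.1 i, p.2 i)) ∈ s} =
      (Measure.pi fun _ : Fin n => fIn.toMeasure.prod fOut.toMeasure).real s := by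
  have h := measurePreserving_arrowProdEquivProdArrow ℕ ℕ (Fin n)
    (fun _ => fIn.toMeasure) (fun _ => fOut.toMeasure)
  exact (h.measureReal_preimage
    (s := {p : Degrees n | (fun i => (p.1 i, p.2 i)) ∈ s}) MeasurableSet.of_discrete.nullMeasurableSet).symm

theorem polyDecay_attemptLaw_deviation {φ : ℕ × ℕ → ℝ} {q c η : ℝ} (hq1 : 1 < q) (hq2 : q ≤ 2)
    (hint : Integrable (fun y => |φ y| ^ q) (fIn.toMeasure.prod fOut.toMeasure))
    (hc : 1 < q * c) (hη : 0 < η) :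
    PolyDecay fun n => (attemptLaw fIn fOut n).real {p | η * (n : ℝ) ^ c <
      |∑ i, φ (p.1 i, p.2 i) - n * ∫ z, φ z ∂(fIn.toMeasure.prod fOut.toMeasure)|} := by
  obtain ⟨K, hK, h⟩ := measureReal_pi_sum_deviation_le Measurable.of_discrete hq1 hq2 hint
  -- At `t = η * n ^ c` the bound `K * n * t ^ (-q)` has order `n ^ (1 - q * c)`.
  refine (PolyDecay.const_mul_rpow (K * η ^ (-q)) (a := q * c - 1) (by linarith)).mono ?_
  filter_upwards [eventually_ge_atTop 1] with n hn
  have hn' : (0 : ℝ) < n := by exact_mod_cast hn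
  refine (attemptLaw_real_eq n _).trans_le ((h n (η * (n : ℝ) ^ c) (by positivity)).trans_eq ?_)
  rw [Real.mul_rpow hη.le (by positivity), ← Real.rpow_mul hn'.le,
    show -(q * c - 1) = 1 + c * -q by ring, Real.rpow_add hn', Real.rpow_one]
  ring

theorem polyDecay_attemptLaw_sum {φ : ℕ × ℕ → ℝ} {ε : ℝ} (hφ : ∀ y, 0 ≤ φ y)
    (hint : Integrable φ (fIn.toMeasure.prod fOut.toMeasure)) (hε : 0 < ε) :
    PolyDecay fun n => (attemptLaw fIn fOut n).real {p | (n : ℝ) ^ (1 + ε) <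
      ∑ i, φ (p.1 i, p.2 i)} := by
  refine (PolyDecay.const_mul_rpow (∫ z, φ z ∂(fIn.toMeasure.prod fOut.toMeasure)) hε).mono ?_
  filter_upwards [eventually_ge_atTop 1] with n hn
  have hn' : (0 : ℝ) < n := by exact_mod_cast hn
  refine (attemptLaw_real_eq n _).trans_le
    ((measureReal_pi_sum_lt_le hint hφ n (t := (n : ℝ) ^ (1 + ε)) (by positivity)).trans_eq ?_)
  rw [Real.rpow_add hn', Real.rpow_one, Real.rpow_neg hn'.le]
  field_simp

/-- Bi-degree sequences whose empirical moments are close to the theoretical ones. -/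
def typical (μ η ε q : ℝ) (n : ℕ) : Set (Degrees n) :=
  {p | ∑ i, (p.1 i : ℝ) * p.2 i ≤ n * (μ ^ 2 + η) ∧ n * (μ - η) ≤ ∑ i, (p.2 i : ℝ) ∧
    ∑ i, (p.1 i : ℝ) ≤ n * (μ + η) ∧ ∑ i, (p.1 i : ℝ) ^ q ≤ (n : ℝ) ^ (1 + ε) ∧
    ∑ i, (p.2 i : ℝ) ^ q ≤ (n : ℝ) ^ (1 + ε) ∧ ∑ i, (p.2 i : ℝ) ^ 2 ≤ (n : ℝ) ^ (1 + ε)}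

variable {α β μ q : ℝ}

/-- Equal means make the excess a sum of centred i.i.d. terms with a moment of order `q`; `hc` says
that the acceptance threshold lies beyond the scale `n ^ (1 / q)`. -/
theorem polyDecay_accepted_compl {δ₀ : ℝ} (hIn : HasTailIndex fIn α) (hOut : HasTailIndex fOut β)
    (hmeanIn : HasMean fIn μ) (hmeanOut : HasMean fOut μ) (hq1 : 1 < q) (hq2 : q ≤ 2)
    (hqα : q < α) (hqβ : q < β) (hc : 1 < q * (1 - kappa α β + δ₀)) :
    PolyDecay fun n => (attemptLaw fIn fOut n).real (accepted α β δ₀ n)ᶜ := by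
  have h1 := hIn.integrable_rpow (by linarith) hqα
  have h2 := hOut.integrable_rpow (by linarith) hqβ
  have hint : Integrable (fun y : ℕ × ℕ => |(y.1 : ℝ) - y.2| ^ q)
      (fIn.toMeasure.prod fOut.toMeasure) := by
    refine ((h1.comp_fst _).add (h2.comp_snd _)).mono' Measurable.of_discrete.aestronglyMeasurable
      (Eventually.of_forall fun y => ?_)
    simp only [Pi.add_apply]
    rw [Real.norm_of_nonneg (by positivity)]
    have e1 : (0 : ℝ) ≤ (y.1 : ℝ) ^ q := by positivity
    have e2 : (0 : ℝ) ≤ (y.2 : ℝ) ^ q := by positivity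
    have e3 : (0 : ℝ) ≤ y.1 := by positivity
    have e4 : (0 : ℝ) ≤ y.2 := by positivity
    rcases le_total (y.1 : ℝ) y.2 with h | h
    · have : |(y.1 : ℝ) - y.2| ^ q ≤ (y.2 : ℝ) ^ q := by
        refine Real.rpow_le_rpow (abs_nonneg _) ?_ (by linarith)
        rw [abs_le]; constructor <;> linarith
      linarith
    · have : |(y.1 : ℝ) - y.2| ^ q ≤ (y.1 : ℝ) ^ q := by
        refine Real.rpow_le_rpow (abs_nonneg _) ?_ (by linarith)
        rw [abs_le]; constructor <;> linarith
      linarith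
  have i1 : Integrable (fun k : ℕ => (k : ℝ)) fIn.toMeasure :=
    integrable_of_integrable_abs_rpow Measurable.of_discrete hq1 (by simpa using h1)
  have i2 : Integrable (fun k : ℕ => (k : ℝ)) fOut.toMeasure :=
    integrable_of_integrable_abs_rpow Measurable.of_discrete hq1 (by simpa using h2)
  have hmean : ∫ y : ℕ × ℕ, ((y.1 : ℝ) - y.2) ∂(fIn.toMeasure.prod fOut.toMeasure) = 0 := by
    rw [integral_sub (i1.comp_fst _) (i2.comp_snd _),
      integral_fun_fst (f := fun k : ℕ => (k : ℝ)), integral_fun_snd (f := fun k : ℕ => (k : ℝ)),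
      hmeanIn.integral_eq, hmeanOut.integral_eq]
    simp
  have h := polyDecay_attemptLaw_deviation hq1 hq2 hint hc one_pos
  rw [hmean] at h
  refine h.mono (Eventually.of_forall fun n => le_of_eq ?_)
  congr 1
  ext p
  simp [accepted, excess]

theorem polyDecay_typical_compl {η ε : ℝ} (hIn : HasTailIndex fIn α) (hOut : HasTailIndex fOut β)
    (hmeanIn : HasMean fIn μ) (hmeanOut : HasMean fOut μ) (hβ : 2 < β) (hq1 : 1 < q) (hq2 : q ≤ 2)
    (hqα : q < α) (hqβ : q < β) (hη : 0 < η) (hε : 0 < ε) :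
    PolyDecay fun n => (attemptLaw fIn fOut n).real (typical μ η ε q n)ᶜ := by
  have h1 := hIn.integrable_rpow (by linarith) hqα
  have h2 := hOut.integrable_rpow (by linarith) hqβ
  have h3 := hOut.integrable_rpow (by norm_num) hβ
  have hc : 1 < q * 1 := by linarith
  have m1 : ∫ y : ℕ × ℕ, (y.1 : ℝ) * y.2 ∂(fIn.toMeasure.prod fOut.toMeasure) = μ ^ 2 := by
    rw [integral_prod_mul (fun k : ℕ => (k : ℝ)) (fun k : ℕ => (k : ℝ)), hmeanIn.integral_eq,
      hmeanOut.integral_eq, sq]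
  have m2 : ∫ y : ℕ × ℕ, (y.2 : ℝ) ∂(fIn.toMeasure.prod fOut.toMeasure) = μ := by
    rw [integral_fun_snd (f := fun k : ℕ => (k : ℝ)), hmeanOut.integral_eq]
    simp
  have m3 : ∫ y : ℕ × ℕ, (y.1 : ℝ) ∂(fIn.toMeasure.prod fOut.toMeasure) = μ := by
    rw [integral_fun_fst (f := fun k : ℕ => (k : ℝ)), hmeanIn.integral_eq]
    simp
  -- Independence of the in- and out-degree gives the product a finite moment of order `q`, although
  -- each factor may have little more.
  have e1 := polyDecay_attemptLaw_deviation (fIn := fIn) (fOut := fOut)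
    (φ := fun y => (y.1 : ℝ) * y.2) hq1 hq2 (by
      refine (h1.mul_prod h2).congr (Eventually.of_forall fun y => ?_)
      simp only [abs_mul, Nat.abs_cast]
      rw [Real.mul_rpow (by positivity) (by positivity)]) hc hη
  have e2 := polyDecay_attemptLaw_deviation (fIn := fIn) (fOut := fOut)
    (φ := fun y => (y.2 : ℝ)) hq1 hq2 (by simpa using h2.comp_snd fIn.toMeasure) hc hη
  have e3 := polyDecay_attemptLaw_deviation (fIn := fIn) (fOut := fOut)
    (φ := fun y => (y.1 : ℝ)) hq1 hq2 (by simpa using h1.comp_fst fOut.toMeasure) hc hη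
  have e4 := polyDecay_attemptLaw_sum (fIn := fIn) (fOut := fOut)
    (φ := fun y => (y.1 : ℝ) ^ q) (fun y => by positivity) (h1.comp_fst fOut.toMeasure) hε
  have e5 := polyDecay_attemptLaw_sum (fIn := fIn) (fOut := fOut)
    (φ := fun y => (y.2 : ℝ) ^ q) (fun y => by positivity) (h2.comp_snd fIn.toMeasure) hε
  have e6 := polyDecay_attemptLaw_sum (fIn := fIn) (fOut := fOut)
    (φ := fun y => (y.2 : ℝ) ^ 2) (fun y => by positivity)
    (by simpa using h3.comp_snd fIn.toMeasure) hε
  rw [m1] at e1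
  rw [m2] at e2
  rw [m3] at e3
  refine (((((e1.add e2).add e3).add e4).add e5).add e6).mono (Eventually.of_forall fun n => ?_)
  simp only [Real.rpow_one]
  refine le_trans (measureReal_mono ?_) (le_trans (measureReal_union_le _ _) (add_le_add_left
    (le_trans (measureReal_union_le _ _) (add_le_add_left (le_trans (measureReal_union_le _ _)
    (add_le_add_left (le_trans (measureReal_union_le _ _) (add_le_add_left
    (measureReal_union_le _ _) _)) _)) _)) _))
  intro p hp
  by_contra hc
  simp only [Set.mem_union, Set.mem_ofPred_eq, not_or, not_lt] at hc
  obtain ⟨⟨⟨⟨⟨c1, c2⟩, c3⟩, c4⟩, c5⟩, c6⟩ := hc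
  rw [abs_le] at c1 c2 c3
  exact hp ⟨by linarith, by linarith, by linarith, c4, c5, c6⟩

end Attempt

/-! ### Conditioning on acceptance. -/

section BiDegree
variable {fIn fOut : PMF ℕ} {α β δ₀ : ℝ}

theorem natAbs_excess_le {n : ℕ} {p : Degrees n} (hp : p ∈ accepted α β δ₀ n) :
    ((excess p).natAbs : ℝ) ≤ (n : ℝ) ^ (1 - kappa α β + δ₀) := by
  rw [Nat.cast_natAbs, Int.cast_abs]
  exact hp

theorem natAbs_excess_le_card {n : ℕ} (hn : 1 ≤ n) (hδ : δ₀ < kappa α β) {p : Degrees n}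
    (hp : p ∈ accepted α β δ₀ n) : (excess p).natAbs ≤ n := by
  have h1 : (1 : ℝ) ≤ n := by exact_mod_cast hn
  have h2 : (n : ℝ) ^ (1 - kappa α β + δ₀) ≤ (n : ℝ) ^ (1 : ℝ) :=
    Real.rpow_le_rpow_of_exponent_le h1 (by linarith)
  rw [Real.rpow_one] at h2
  exact_mod_cast (natAbs_excess_le hp).trans h2

theorem measure_accepted_ge {n : ℕ}
    (h : (attemptLaw fIn fOut n).real (accepted α β δ₀ n)ᶜ < 1 / 2) :
    1 / 2 ≤ (attemptLaw fIn fOut n).real (accepted α β δ₀ n) := by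
  rw [probReal_compl_eq_one_sub .of_discrete] at h
  linarith

/-- Almost sure termination amounts to a positive acceptance probability; otherwise the conditional
law would be zero. On accepted attempts `|Δ_n| ≤ n`, so enough nodes are available for the
adjustment. -/
theorem isProbabilityMeasure_biDegreeLaw {n : ℕ} (hn : 1 ≤ n) (hδ : δ₀ < kappa α β)
    (h : (attemptLaw fIn fOut n).real (accepted α β δ₀ n)ᶜ < 1 / 2) :
    IsProbabilityMeasure (biDegreeLaw fIn fOut α β δ₀ n) := by
  have hne : attemptLaw fIn fOut n (accepted α β δ₀ n) ≠ 0 := fun h0 => by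
    have := measure_accepted_ge h
    rw [measureReal_def, h0] at this
    norm_num at this
  have := cond_isProbabilityMeasure hne
  refine ⟨?_⟩
  rw [biDegreeLaw, Measure.bind_apply .univ Measurable.of_discrete.aemeasurable]
  have hae : ∀ᵐ p ∂(ProbabilityTheory.cond (attemptLaw fIn fOut n) (accepted α β δ₀ n)),
      adjustLaw p Set.univ = 1 := by
    filter_upwards [ae_cond_mem (μ := attemptLaw fIn fOut n) (s := accepted α β δ₀ n) .of_discrete]
      with p hp
    exact adjustLaw_univ p (natAbs_excess_le_card hn hδ hp)
  rw [lintegral_congr_ae hae, lintegral_one, measure_univ]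

/-- Bounding `P(τ ≤ k)` by its value on a good set of attempts and twice the probability of the
complement of that set. -/
theorem probTauLE_le {n k : ℕ} (h : (attemptLaw fIn fOut n).real (accepted α β δ₀ n)ᶜ < 1 / 2)
    {G : Set (Degrees n)} {c : ℝ} (hc : 0 ≤ c)
    (hG : ∀ p ∈ accepted α β δ₀ n, p ∈ G → ∀ S : Finset (Fin n), S.card = (excess p).natAbs →
      (n : ℝ≥0∞)⁻¹ * ∑ root, drawLaw (adjust p S).2 {ω | tau (adjust p S) root ω ≤ (k : ℕ∞)} ≤
        ENNReal.ofReal c) :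
    probTauLE fIn fOut α β δ₀ n k ≤
      ENNReal.ofReal (c + 2 * (attemptLaw fIn fOut n).real Gᶜ) := by
  classical
  have hA := measure_accepted_ge h
  have hne : attemptLaw fIn fOut n (accepted α β δ₀ n) ≠ 0 := fun h0 => by
    rw [measureReal_def, h0] at hA
    norm_num at hA
  have := cond_isProbabilityMeasure hne
  rw [probTauLE, biDegreeLaw]
  refine (Measure.lintegral_bind_le _ _ _).trans ?_
  have hae : ∀ᵐ p ∂(ProbabilityTheory.cond (attemptLaw fIn fOut n) (accepted α β δ₀ n)),
      ∫⁻ d, (n : ℝ≥0∞)⁻¹ * ∑ root, drawLaw d.2 {ω | tau d root ω ≤ (k : ℕ∞)} ∂(adjustLaw p) ≤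
        ENNReal.ofReal c + Gᶜ.indicator 1 p := by
    filter_upwards [ae_cond_mem (μ := attemptLaw fIn fOut n) (s := accepted α β δ₀ n) .of_discrete]
      with p hp
    by_cases hpG : p ∈ G
    · exact le_add_right (lintegral_adjustLaw_le p (hG p hp hpG))
    · rw [Set.indicator_of_mem (by exact hpG)]
      exact le_add_left (lintegral_adjustLaw_le p fun S _ => average_drawLaw_le_one _ _)
  refine (lintegral_mono_ae hae).trans ?_
  rw [lintegral_add_left measurable_const, lintegral_const, measure_univ, mul_one,
    lintegral_indicator_one .of_discrete, ENNReal.ofReal_add hc (by positivity)]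
  gcongr
  rw [← ofReal_measureReal]
  refine ENNReal.ofReal_le_ofReal ?_
  rw [measureReal_def, cond_apply .of_discrete, ENNReal.toReal_mul, ENNReal.toReal_inv,
    ← measureReal_def, ← measureReal_def]
  -- This is the only cost of conditioning.
  have h2 : ((attemptLaw fIn fOut n).real (accepted α β δ₀ n))⁻¹ ≤ 2 := by
    rw [inv_le_comm₀ (by linarith) two_pos]
    linarith
  exact mul_le_mul h2 (measureReal_mono Set.inter_subset_right) measureReal_nonneg two_pos.le

end BiDegree

/-! ### Powers of `n` and the choice of exponents. -/

theorem pow_exp_le_rpow {n k : ℕ} {s h : ℝ} (hn : 1 ≤ n) (hs : 0 ≤ s)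
    (hk : (k : ℝ) ≤ h * Real.log n) : Real.exp s ^ k ≤ (n : ℝ) ^ (h * s) := by
  have hn' : (0 : ℝ) < n := by exact_mod_cast hn
  rw [← Real.exp_nat_mul, Real.rpow_def_of_pos hn']
  refine Real.exp_le_exp.2 ?_
  nlinarith

/-- The coupling bound for a bi-degree sequence with controlled empirical moments, in powers of
`n`, the number of draws considered being of order `n ^ b`. -/
theorem average_measure_tau_le_le_rpow {n k : ℕ} {d : Degrees n} {μ s h b ε : ℝ} (hn : 1 ≤ n)
    (hμ : 0 < μ) (hs : 0 < s) (hb : 0 ≤ b) (hk : (k : ℝ) ≤ h * Real.log n)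
    (hL : n * (μ / 2) ≤ ∑ i, (d.2 i : ℝ)) (hN : ∑ i, (d.1 i : ℝ) ≤ n * (2 * μ + 1))
    (hS : ∑ i, (d.2 i : ℝ) ^ 2 ≤ 4 * (n : ℝ) ^ (1 + ε))
    (hM : ∑ i, (d.1 i : ℝ) * d.2 i ≤ Real.exp s * ∑ i, (d.2 i : ℝ)) :
    (n : ℝ≥0∞)⁻¹ * ∑ root : Fin n, drawLaw d.2 {ω | tau d root ω ≤ (k : ℕ∞)} ≤
      ENNReal.ofReal (2 * (n : ℝ) ^ (-(1 - b)) + 64 / μ ^ 2 * (n : ℝ) ^ (-(1 - 2 * b - ε)) +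
        (2 * μ + 1) * (Real.exp s / (Real.exp s - 1)) * (n : ℝ) ^ (-(b - h * s))) := by
  have hn' : (0 : ℝ) < n := by exact_mod_cast hn
  have hmul : ∀ a : ℝ, (n : ℝ) * (n : ℝ) ^ a = (n : ℝ) ^ (1 + a) := fun a => by
    rw [Real.rpow_add hn', Real.rpow_one]
  have hM1 : 1 < Real.exp s := Real.one_lt_exp_iff.2 hs
  set L := ∑ i, (d.2 i : ℝ) with hLdef
  have hLpos : 0 < L := lt_of_lt_of_le (by positivity) hL
  have hD : 0 < ∑ i, d.2 i := by
    have : (0 : ℝ) < ((∑ i, d.2 i : ℕ) : ℝ) := by rw [Nat.cast_sum]; exact hLpos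
    exact_mod_cast this
  have hnb : (1 : ℝ) ≤ (n : ℝ) ^ b := Real.one_le_rpow (by exact_mod_cast hn) hb
  set x := ⌈(n : ℝ) ^ b⌉₊ with hxdef
  have hx1 : (n : ℝ) ^ b ≤ x := Nat.le_ceil _
  have hx2 : (x : ℝ) ≤ 2 * (n : ℝ) ^ b := by
    have := (Nat.ceil_lt_add_one (by positivity : 0 ≤ (n : ℝ) ^ b)).le
    linarith
  have hx : 0 < x := Nat.ceil_pos.2 (by linarith)
  refine (average_measure_tau_le_le d hM1 hD hM k hx).trans (ENNReal.ofReal_le_ofReal ?_)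
  rw [← hLdef]
  have hM0 : 0 < Real.exp s - 1 := by linarith
  refine add_le_add (add_le_add ?_ ?_) ?_
  · rw [div_le_iff₀ hn', mul_assoc, mul_comm _ (n : ℝ), hmul, show 1 + -(1 - b) = b by ring]
    exact hx2
  · calc (x : ℝ) ^ 2 * ((∑ i, (d.2 i : ℝ) ^ 2) / L ^ 2)
        ≤ (2 * (n : ℝ) ^ b) ^ 2 * (4 * (n : ℝ) ^ (1 + ε) / (n * (μ / 2)) ^ 2) := by gcongr
      _ = 64 / μ ^ 2 * (((n : ℝ) ^ b) ^ 2 * (n : ℝ) ^ (1 + ε) / n ^ 2) := by field_simp; norm_num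
      _ = _ := by
        congr 1
        rw [← Real.rpow_mul_natCast hn'.le, ← Real.rpow_natCast (n : ℝ) 2, ← Real.rpow_add hn',
          ← Real.rpow_sub hn']
        congr 1
        push_cast
        ring
  · have h1 : (∑ i, (d.1 i : ℝ)) / n ≤ 2 * μ + 1 := by
      rw [div_le_iff₀ hn']
      linarith
    have h2 := pow_exp_le_rpow hn hs.le hk
    calc (∑ i, (d.1 i : ℝ)) / n * (Real.exp s ^ (k + 1) / (Real.exp s - 1)) / x
        ≤ (2 * μ + 1) * ((n : ℝ) ^ (h * s) * Real.exp s / (Real.exp s - 1)) / (n : ℝ) ^ b := by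
          rw [pow_succ]
          gcongr
      _ = (2 * μ + 1) * (Real.exp s / (Real.exp s - 1)) * ((n : ℝ) ^ (h * s) / (n : ℝ) ^ b) := by
          ring
      _ = _ := by
          rw [← Real.rpow_sub hn']
          congr 2
          ring

/-- The empirical moments of a typical accepted attempt are still controlled after the
adjustment. -/
theorem eventually_adjust_moments {α β δ₀ μ q η ε M : ℝ} (hμ : 1 < μ) (hδ : δ₀ < kappa α β)
    (hq : 1 < q) (hε : 0 < ε) (hεq : ε ≤ (q - 1) * (kappa α β - δ₀) / 4) (hη : 0 < η)
    (hημ : η ≤ μ / 2) (hM : μ ^ 2 + 2 * η ≤ M * (μ - η)) (hM0 : 0 ≤ M) :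
    ∀ᶠ n : ℕ in atTop, ∀ p ∈ accepted α β δ₀ n, p ∈ typical μ η ε q n →
      ∀ S : Finset (Fin n), S.card = (excess p).natAbs →
        n * (μ / 2) ≤ ∑ i, ((adjust p S).2 i : ℝ) ∧
        ∑ i, ((adjust p S).1 i : ℝ) ≤ n * (2 * μ + 1) ∧
        ∑ i, ((adjust p S).2 i : ℝ) ^ 2 ≤ 4 * (n : ℝ) ^ (1 + ε) ∧
        ∑ i, ((adjust p S).1 i : ℝ) * (adjust p S).2 i ≤
          M * ∑ i, ((adjust p S).2 i : ℝ) := by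
  set c := kappa α β - δ₀ with hc
  have hc0 : 0 < c := by linarith
  have hqc : 0 < (q - 1) * c := by nlinarith
  have hsmall := ((PolyDecay.const_mul_rpow 1 (half_pos hc0)).add
    (PolyDecay.const_mul_rpow 1 (by linarith : 0 < (q - 1) * c / 2 - ε))).eventually_lt hη
  filter_upwards [hsmall, eventually_ge_atTop 1] with n hlt hn p hacc htyp S hS
  have hn' : (0 : ℝ) < n := by exact_mod_cast hn
  have hmul : ∀ a : ℝ, (n : ℝ) * (n : ℝ) ^ a = (n : ℝ) ^ (1 + a) := fun a => by
    rw [Real.rpow_add hn', Real.rpow_one]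
  have hn1 : (1 : ℝ) ≤ n := by exact_mod_cast hn
  obtain ⟨t1, t2, t3, t4, t5, t6⟩ := htyp
  have hD := sum_le_sum_adjust_snd p S
  refine ⟨?_, ?_, ?_, ?_⟩
  · nlinarith
  · have := sum_adjust_fst_le p S
    nlinarith
  · have h1 := sum_sq_adjust_snd_le p S
    have h2 : (n : ℝ) ^ (1 : ℝ) ≤ (n : ℝ) ^ (1 + ε) :=
      Real.rpow_le_rpow_of_exponent_le hn1 (by linarith)
    rw [Real.rpow_one] at h2
    linarith
  -- As `S` has at most `n ^ (1 - c)` elements, this `T` leaves errors `n ^ (1 - c / 2)` and `n ^ (1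
  -- + ε - (q - 1) * c / 2)`, both `o(n)` by the choice of `ε`.
  · have h1 := sum_mul_adjust_le p S hq.le (T := (n : ℝ) ^ (c / 2)) (by positivity) t4 t5
    have hcard : (S.card : ℝ) ≤ (n : ℝ) ^ (1 - c) := by
      rw [hS]
      convert natAbs_excess_le hacc using 2
      rw [hc]
      ring
    have h2 : S.card * (n : ℝ) ^ (c / 2) + ((n : ℝ) ^ (c / 2)) ^ (1 - q) * (n : ℝ) ^ (1 + ε) ≤
        n * η := by
      calc _ ≤ (n : ℝ) ^ (1 - c) * (n : ℝ) ^ (c / 2) +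
            ((n : ℝ) ^ (c / 2)) ^ (1 - q) * (n : ℝ) ^ (1 + ε) := by gcongr
        _ = n * (1 * (n : ℝ) ^ (-(c / 2)) + 1 * (n : ℝ) ^ (-((q - 1) * c / 2 - ε))) := by
          rw [← Real.rpow_mul hn'.le, ← Real.rpow_add hn', ← Real.rpow_add hn', one_mul, one_mul,
            mul_add, hmul, hmul]
          congr 2 <;> ring
        _ ≤ _ := by gcongr
    calc _ ≤ n * (μ ^ 2 + η) + n * η := by linarith
      _ = n * (μ ^ 2 + 2 * η) := by ring
      _ ≤ n * (M * (μ - η)) := by gcongr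
      _ = M * (n * (μ - η)) := by ring
      _ ≤ M * ∑ i, ((adjust p S).2 i : ℝ) := by
        gcongr
        exact t2.trans hD

/-- Let `γ = 1 - κ₀ + δ₀`. Since `κ₀ ≤ 1 - 1/α`, `κ₀ ≤ 1/2` and `δ₀ > 0`, one has `1/γ < min α 2`,
and any `q` strictly between works; `δ₀ < κ₀` gives `γ < 1`, hence `q > 1`. -/
theorem exists_moment_exponent {α β δ₀ : ℝ} (hα : 1 < α) (hβ : 2 < β) (hδ₀ : 0 < δ₀)
    (hδ : δ₀ < kappa α β) :
    ∃ q : ℝ, 1 < q ∧ q ≤ 2 ∧ q < α ∧ q < β ∧ 1 < q * (1 - kappa α β + δ₀) := by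
  have k1 : kappa α β ≤ 1 - α⁻¹ := (min_le_left _ _).trans (min_le_left _ _)
  have k2 : kappa α β ≤ 1 / 2 := min_le_right _ _
  set γ := 1 - kappa α β + δ₀ with hγ
  have hγ0 : 0 < γ := by linarith
  have hlt : γ⁻¹ < min α 2 := by
    refine lt_min ?_ ?_
    · rw [inv_lt_comm₀ hγ0 (by linarith)]
      linarith
    · rw [inv_lt_comm₀ hγ0 two_pos]
      linarith
  obtain ⟨q, hq1, hq2⟩ := exists_between hlt
  have hq3 := lt_min_iff.1 hq2
  refine ⟨q, lt_trans ?_ hq1, hq3.2.le, hq3.1, by linarith, ?_⟩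
  · exact (one_lt_inv₀ hγ0).2 (by linarith)
  · rw [inv_lt_iff_one_lt_mul₀ hγ0] at hq1
    linarith

end DirectedConfiguration

open DirectedConfiguration in
theorem lemma1 (fIn fOut : PMF ℕ) (α β δ₀ μ h : ℝ)
    (hα : 1 < α) (hβ : 2 < β)
    (hIn : DirectedConfiguration.HasTailIndex fIn α)
    (hOut : DirectedConfiguration.HasTailIndex fOut β)
    (hmeanIn : DirectedConfiguration.HasMean fIn μ)
    (hmeanOut : DirectedConfiguration.HasMean fOut μ)
    (hμ : 1 < μ)
    (hδ₀ : 0 < δ₀) (hδ₀κ : δ₀ < DirectedConfiguration.kappa α β)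
    (hh : 0 < h) (hhμ : h < 1 / (2 * Real.log μ)) :
    ∃ δ : ℝ, 0 < δ ∧ ∃ C : ℝ, ∀ᶠ n : ℕ in atTop,
      IsProbabilityMeasure (DirectedConfiguration.biDegreeLaw fIn fOut α β δ₀ n) ∧
      ∀ k : ℕ, 1 ≤ k → (k : ℝ) ≤ h * Real.log (n : ℝ) →
        DirectedConfiguration.probTauLE fIn fOut α β δ₀ n k ≤
          ENNReal.ofReal (C * (n : ℝ) ^ (-δ)) := by
  obtain ⟨q, hq1, hq2, hqα, hqβ, hqc⟩ := exists_moment_exponent hα hβ hδ₀ hδ₀κ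
  have hlogμ : 0 < Real.log μ := Real.log_pos hμ
  -- The branching mean `exp s` is taken slightly above `μ` to absorb fluctuations, yet small enough
  -- that `h * s < 1 / 2`.
  obtain ⟨s, hs1, hs2⟩ : ∃ s, Real.log μ < s ∧ s < 1 / (2 * h) := by
    refine exists_between ?_
    rw [lt_div_iff₀ (by positivity)] at hhμ ⊢
    linarith
  have hs0 : 0 < s := hlogμ.trans hs1
  have hhs : h * s < 1 / 2 := by
    rw [lt_div_iff₀ (by positivity)] at hs2
    linarith
  have hhs0 : 0 < h * s := by positivity
  have hμM : μ < Real.exp s := (Real.log_lt_iff_lt_exp (by linarith)).1 hs1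
  set M := Real.exp s with hM
  obtain ⟨b, hb1, hb2⟩ := exists_between hhs
  obtain ⟨ε, hε0, hε⟩ := exists_between
    (lt_min (by nlinarith : 0 < (q - 1) * (kappa α β - δ₀) / 4) (by linarith : 0 < 1 - 2 * b))
  have hε' := lt_min_iff.1 hε
  -- The second bound on `η` is `μ ^ 2 + 2 * η ≤ M * (μ - η)` solved for `η`, with strict
  -- inequality.
  obtain ⟨η, hη0, hη⟩ := exists_between (lt_min (by linarith : 0 < μ / 2)
    (div_pos (mul_pos (by linarith : 0 < μ) (sub_pos.2 hμM)) (by linarith : 0 < M + 2)))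
  have hη' := lt_min_iff.1 hη
  have hηM : μ ^ 2 + 2 * η ≤ M * (μ - η) := by
    have := (lt_div_iff₀ (by linarith : 0 < M + 2)).1 hη'.2
    nlinarith
  have hacc := polyDecay_accepted_compl hIn hOut hmeanIn hmeanOut hq1 hq2 hqα hqβ hqc
  have htyp := polyDecay_typical_compl hIn hOut hmeanIn hmeanOut hβ hq1 hq2 hqα hqβ hη0 hε0
  obtain ⟨δ, hδ, C, -, hbound⟩ := (((PolyDecay.const_mul_rpow 2 (by linarith : 0 < 1 - b)).add
    (PolyDecay.const_mul_rpow (64 / μ ^ 2) (by linarith : 0 < 1 - 2 * b - ε))).add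
    (PolyDecay.const_mul_rpow ((2 * μ + 1) * (M / (M - 1))) (sub_pos.2 hb1))).add
    (htyp.const_mul two_pos.le)
  refine ⟨δ, hδ, C, ?_⟩
  filter_upwards [hbound, hacc.eventually_lt (by norm_num : (0 : ℝ) < 1 / 2),
    eventually_adjust_moments hμ hδ₀κ hq1 hε0 hε'.1.le hη0 hη'.1.le hηM (by linarith),
    eventually_ge_atTop 1] with n hn1 hn2 hn3 hn
  refine ⟨isProbabilityMeasure_biDegreeLaw hn hδ₀κ hn2, fun k _ hk => ?_⟩
  have hM1 : 0 < M - 1 := by linarith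
  refine (probTauLE_le hn2 (by positivity) fun p hp hpG S hS => ?_).trans
    (ENNReal.ofReal_le_ofReal hn1)
  obtain ⟨m1, m2, m3, m4⟩ := hn3 p hp hpG S hS
  exact average_measure_tau_le_le_rpow hn (by linarith) hs0 (by linarith) hk m1 m2 m3 m4
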